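/- Let $n\ge 1$, $d\ge 0$ be integers, let $\Sigma[x]$ be the set of sums of squares in $\mathbb{R}[x_1,\dots,x_n]$, and put $g_i=1-x_i^2$ $(1\le i\le n)$. For $k\in\mathbb{N}$ let $$\mathcal{Q}_k=\Big\{\sigma_0+\sum_{i=1}^n\sigma_i g_i:\ \sigma_i\in\Sigma[x],\ \deg\sigma_0\le k,\ \deg(\sigma_ig_i)\le k\Big\},$$ $$\mathcal{T}_k=\Big\{\sum_{I\subseteq\{1,\dots,n\}}\sigma_I\prod_{i\in I}g_i:\ \sigma_I\in\Sigma[x],\ \deg\Big(\sigma_I\prod_{i\in I}g_i\Big)\le k\Big\}$$ be the truncated quadratic module $\mathcal{Q}(1-x_1^2,\dots,1-x_n^2)_k$ and the truncated preordering of the $g_i$. For a polynomial $f$ that is strictly positive on $[-1,1]^n$, let $f_{\max}$ and $f_{\min}$ be its maximum and minimum on $[-1,1]^n$. Call $\mathfrak{c}$ a Chebyshev constant if $1\le\mathfrak{c}\le e^5$ and $T_m\big(\tfrac{1}{1-\delta}\big)\le\mathfrak{c}$ for all integers $m\ge2$ and all $0<\delta\le 1/m^2$, where $T_m$ is the Chebyshev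 polynomial of the first kind of degree $m$. Call $C>0$ a Schmüdgen constant for $(n,d)$ if every $f\in\mathbb{R}[x_1,\dots,x_n]$ of degree $d$ that is strictly positive on $[-1,1]^n$ lies in $\mathcal{T}_{(r+1)n}$ for every integer $r\ge\max\{(C\cdot f_{\max}/f_{\min})^{1/2},\ \pi d\sqrt{2n}\}$. **Theorem.** 1. A Chebyshev constant exists. 2. There are Schmüdgen constants $C(n,d)$ for all $n\ge1$, $d\ge0$, such that for each fixed $d$, $C(n,d)$ is bounded by a polynomial in $n$, and for each fixed $n$, $C(n,d)$ is bounded by a polynomial in $d$. 3. Let $\mathfrak{c}$ be any Chebyshev constant, and let $C(n,d)$ be any Schmüdgen constant for $(n,d)$. If $f\in\mathbb{R}[x_1,\dots,x_n]$ has degree $d$ and is strictly positive on $[-1,1]^n$, then $f\in\mathcal{Q}_{rn}$ for every integer $$r\ \ge\ 4\mathfrak{c}\,d^2(\log n)\,\frac{f_{\max}}{f_{\min}}+\max\Big\{\pi d\sqrt{2n},\ \Big(2\mathfrak{c}\,\frac{f_{\max}}{f_{\min}}\,C(n,d)\Big)^{1/2}\Big\}.$$ 4. In particular, for fixed $n,d$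 the bound is $O(f_{\max}/f_{\min})$: there is a constant $a=a(n,d)>0$ such that every $f\in\mathbb{R}[x_1,\dots,x_n]$ of degree $d$ that is strictly positive on $[-1,1]^n$ lies in $\mathcal{Q}_{rn}$ for every integer $r\ge a\cdot f_{\max}/f_{\min}$. -/

import Mathlib

noncomputable section

/-- The hypercube `[-1, 1]^n`. -/
def hypercube (n : ℕ) : Set (Fin n → ℝ) :=
  Set.Icc (fun _ => -1) (fun _ => 1)

/-- The polynomials `1 - x_i ^ 2` defining the hypercube. -/
def cubeConstraint (n : ℕ) (i : Fin n) : MvPolynomial (Fin n) ℝ :=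
  1 - MvPolynomial.X i ^ 2

/-- The truncated quadratic module `Q(g)_r`: all `σ₀ + ∑ σ_i g_i` with sums of squares `σ_i`
and `deg σ₀ ≤ r`, `deg (σ_i g_i) ≤ r`. -/
def truncatedQuadraticModule {n m : ℕ} (g : Fin m → MvPolynomial (Fin n) ℝ) (r : ℕ) :
    Set (MvPolynomial (Fin n) ℝ) :=
  {p | ∃ (s₀ : MvPolynomial (Fin n) ℝ) (s : Fin m → MvPolynomial (Fin n) ℝ),
    IsSumSq s₀ ∧ (∀ i, IsSumSq (s i)) ∧
    s₀.totalDegree ≤ r ∧ (∀ i, (s i * g i).totalDegree ≤ r) ∧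
    p = s₀ + ∑ i, s i * g i}

/-- The truncated preordering `T(g)_r`: all `∑_I σ_I g_I` over `I ⊆ [m]`, with sums of squares
`σ_I`, `g_I = ∏_{i ∈ I} g_i` and `deg (σ_I g_I) ≤ r`. -/
def truncatedPreordering {n m : ℕ} (g : Fin m → MvPolynomial (Fin n) ℝ) (r : ℕ) :
    Set (MvPolynomial (Fin n) ℝ) :=
  {p | ∃ s : Finset (Fin m) → MvPolynomial (Fin n) ℝ,
    (∀ I, IsSumSq (s I)) ∧ (∀ I, (s I * ∏ i ∈ I, g i).totalDegree ≤ r) ∧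
    p = ∑ I, s I * ∏ i ∈ I, g i}

/-- `f` is a polynomial of degree `d`, strictly positive on the hypercube, with maximum `fmax`
and minimum `fmin` there. -/
structure IsPositiveOnCube {n : ℕ} (f : MvPolynomial (Fin n) ℝ) (d : ℕ) (fmax fmin : ℝ) :
    Prop where
  degree_eq : f.totalDegree = d
  pos : ∀ x ∈ hypercube n, 0 < MvPolynomial.eval x f
  isGreatest : IsGreatest ((fun x => MvPolynomial.eval x f) '' hypercube n) fmax
  isLeast : IsLeast ((fun x => MvPolynomial.eval x f) '' hypercube n) fmin

/-- `c` is a constant `1 ≤ c ≤ e ^ 5` with `T_d (1 / (1 - δ)) ≤ c` for all `d ≥ 2` and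
`0 < δ ≤ 1 / d ^ 2`, where `T_d` is the Chebyshev polynomial of degree `d`. -/
def IsChebyshevConstant (c : ℝ) : Prop :=
  1 ≤ c ∧ c ≤ Real.exp 5 ∧
    ∀ d : ℕ, 2 ≤ d → ∀ δ : ℝ, 0 < δ → δ ≤ 1 / (d : ℝ) ^ 2 →
      (Polynomial.Chebyshev.T ℝ d).eval (1 / (1 - δ)) ≤ c

/-- `C` is an admissible constant in the effective Schmüdgen Positivstellensatz on `[-1, 1]^n`
for polynomials of degree `d`. -/
def IsSchmudgenConstant (n d : ℕ) (C : ℝ) : Prop :=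
  0 < C ∧ ∀ (f : MvPolynomial (Fin n) ℝ) (fmax fmin : ℝ), IsPositiveOnCube f d fmax fmin →
    ∀ r : ℕ, max (√(C * (fmax / fmin))) (Real.pi * d * √(2 * n)) ≤ (r : ℝ) →
      f ∈ truncatedPreordering (cubeConstraint n) ((r + 1) * n)

end

/-! The obstacle is passing from the preordering to the quadratic module: products of the `g_i` must
be certified by the single `g_i`. A dilation pays for this. With `R ^ (2k) = n`, the cube `[-R,
R]^n` contains the region `∑ x_j ^ (2k) ≤ n`, cut out by the single polynomial `h = ∑ (1 - x_j ^
(2k))`. A quadratic module with one generator is closed under products because `h ^ 2` is a square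
(`powerModule_mul_mem`). It contains each `1 - (x_i / R) ^ 2` (`one_sub_sq_mem_powerModule`), and
`h` itself is a combination of the `g_i` by geometric sums. So a preordering certificate for `f(R
x)` on the unit cube, scaled back, becomes a quadratic module certificate for `f`, at a cost of `2
(k - 1)` degrees per variable (`scaleHom_mem_truncatedQuadraticModule`).

It remains that `f(R x)` is still positive with a comparable ratio. On each line through the origin
`f` is a univariate polynomial of degree at most `d` bounded by `fmax` on `[-1, 1]`, so its growth
beyond `1` is governed by `T_d` (`abs_eval_le_and_sub_le_of_one_le`). Convexity of `T_d` gives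
`T_d(R) - 1 ≤ c d² δ` for `R = 1 / (1 - δ)`, where `δ ≤ log n / (2k)`. Hence `2k` of order `c d²
(log n) fmax / fmin` loses at most half the minimum. For `n = 1` the logarithm vanishes, and
factoring `f` into irreducibles gives a direct certificate.

The Schmüdgen constants come from a polynomial kernel. A tensor product of univariate kernels, each
a visible element of the interval's quadratic module, acts diagonally on Chebyshev products with
eigenvalues close to `1`. Applying the inverse operator to `f` keeps it nonnegative on a grid, and
an exact quadrature then writes `f` as a nonnegative combination of kernels
(`mem_truncatedPreordering_of_kernel`). -/

noncomputable section

/-! ### Chebyshev kernels and their certificates on the interval -/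

section UnivariateKernel

open Polynomial
open Polynomial.Chebyshev hiding C

/-- At `x = cos θ` the second term is `sin kθ sin lθ`, so this is the addition formula for the
cosine, valid at infinitely many points. -/
theorem chebyshev_T_sub (k l : ℤ) :
    T ℝ k * T ℝ l + (1 - X ^ 2) * (U ℝ (k - 1) * U ℝ (l - 1)) = T ℝ (k - l) := by
  refine Polynomial.eq_of_infinite_eval_eq _ _
    ((Set.Icc_infinite (show (-1 : ℝ) < 1 by norm_num)).mono fun x hx => ?_)
  obtain ⟨θ, rfl⟩ : ∃ θ, x = Real.cos θ := ⟨Real.arccos x, (Real.cos_arccos hx.1 hx.2).symm⟩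
  have hk := U_real_cos θ (k - 1)
  have hl := U_real_cos θ (l - 1)
  have hs := Real.sin_sq_add_cos_sq θ
  simp only [Set.mem_ofPred_eq, eval_add, eval_mul, eval_sub, eval_one, eval_pow, eval_X, T_real_cos]
  push_cast at hk hl ⊢
  rw [sub_add_cancel] at hk hl
  rw [sub_mul (k : ℝ), Real.cos_sub, ← hk, ← hl]
  linear_combination (-(U ℝ (k - 1)).eval (Real.cos θ) * (U ℝ (l - 1)).eval (Real.cos θ)) * hs

/-- The Chebyshev kernel with weights `a 0, …, a (m - 1)` and second argument `cos φ`. -/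
def chebyshevKernel (a : ℕ → ℝ) (m : ℕ) (φ : ℝ) : ℝ[X] :=
  ∑ k ∈ Finset.range m, ∑ l ∈ Finset.range m,
    C (a k * a l * Real.cos (((k - l : ℤ) : ℝ) * φ)) * T ℝ (k - l)

/-- Both `cos((k - l)φ)` and `T_{k-l}` split into two products of a `k`-factor and an `l`-factor, so
the double sum becomes four squares, two of them weighted by `1 - X ^ 2`. -/
theorem chebyshevKernel_eq (a : ℕ → ℝ) (m : ℕ) (φ : ℝ) :
    chebyshevKernel a m φ =
      ((∑ k ∈ Finset.range m, C (a k * Real.cos (k * φ)) * T ℝ k) ^ 2 +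
        (∑ k ∈ Finset.range m, C (a k * Real.sin (k * φ)) * T ℝ k) ^ 2) +
      ((∑ k ∈ Finset.range m, C (a k * Real.cos (k * φ)) * U ℝ (k - 1)) ^ 2 +
        (∑ k ∈ Finset.range m, C (a k * Real.sin (k * φ)) * U ℝ (k - 1)) ^ 2) * (1 - X ^ 2) := by
  simp only [chebyshevKernel, pow_two (Finset.sum _ _), Finset.sum_mul_sum]
  simp only [Finset.sum_mul, ← Finset.sum_add_distrib]
  refine Finset.sum_congr rfl fun k _ => Finset.sum_congr rfl fun l _ => ?_
  rw [← chebyshev_T_sub]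
  push_cast
  rw [sub_mul, Real.cos_sub]
  simp only [map_mul, map_add]
  ring

theorem natDegree_sum_C_mul_le {m e : ℕ} (b : ℕ → ℝ) (P : ℕ → ℝ[X])
    (h : ∀ k < m, (P k).natDegree ≤ e) :
    (∑ k ∈ Finset.range m, C (b k) * P k).natDegree ≤ e :=
  natDegree_sum_le_of_forall_le _ _ fun k hk =>
    (natDegree_C_mul_le _ _).trans (h k (Finset.mem_range.1 hk))

theorem exists_isSumSq_chebyshevKernel (a : ℕ → ℝ) {q : ℕ} (hq : 1 ≤ q) (φ : ℝ) :
    ∃ A B : ℝ[X], IsSumSq A ∧ IsSumSq B ∧ A.natDegree ≤ 4 * q ∧ B.natDegree ≤ 4 * q - 2 ∧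
      chebyshevKernel a (2 * q + 1) φ = A + B * (1 - X ^ 2) := by
  refine ⟨_, _, ?_, ?_, ?_, ?_, chebyshevKernel_eq a _ φ⟩
  · exact (IsSquare.sq _).isSumSq.add (IsSquare.sq _).isSumSq
  · exact (IsSquare.sq _).isSumSq.add (IsSquare.sq _).isSumSq
  · have hT : ∀ k < 2 * q + 1, (T ℝ (k : ℤ)).natDegree ≤ 2 * q := fun k hk => by
      rw [natDegree_T]; omega
    refine natDegree_add_le_of_degree_le ?_ ?_ <;>
    · refine (natDegree_pow_le_of_le 2 (natDegree_sum_C_mul_le _ _ hT)).trans (by omega)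
  · have hU : ∀ k < 2 * q + 1, (U ℝ ((k : ℤ) - 1)).natDegree ≤ 2 * q - 1 := fun k hk => by
      -- The term `k = 0` involves `U_{-1} = 0`; treating it apart keeps the degree bound at `2q -
      -- 1`.
      rcases k with _ | k
      · simp
      · rw [show (((k + 1 : ℕ) : ℤ) - 1) = (k : ℤ) by push_cast; ring, natDegree_U_natCast]; omega
    refine natDegree_add_le_of_degree_le ?_ ?_ <;>
    · refine (natDegree_pow_le_of_le 2 (natDegree_sum_C_mul_le _ _ hU)).trans (by omega)

end UnivariateKernel

/-! ### Orthogonality of cosines on equidistant angles -/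

section DiscreteOrthogonality

/-- The `j`-th of `N` equidistant angles. -/
def gridAngle (N : ℕ) (j : Fin N) : ℝ := 2 * Real.pi * (j : ℕ) / N

/-- This is the real part of a geometric sum with ratio `ζ ^ t ≠ 1`, where `ζ` is a primitive `N`-th
root of unity. -/
theorem sum_cos_gridAngle {N : ℕ} (hN : N ≠ 0) {t : ℤ} (ht : ¬ (N : ℤ) ∣ t) :
    ∑ j : Fin N, Real.cos (t * gridAngle N j) = 0 := by
  have hζ := Complex.isPrimitiveRoot_exp N hN
  set ζ := Complex.exp (2 * Real.pi * Complex.I / N) with hζdef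
  have h1 : ζ ^ t ≠ 1 := fun h => ht ((hζ.zpow_eq_one_iff_dvd t).1 h)
  have h2 : (ζ ^ t) ^ N = 1 := by
    rw [← zpow_natCast, ← zpow_mul, mul_comm, zpow_mul, zpow_natCast, hζ.pow_eq_one, one_zpow]
  have h3 : ∑ j ∈ Finset.range N, (ζ ^ t) ^ j = 0 := by
    rw [geom_sum_eq h1, h2, sub_self, zero_div]
  have h4 : ∀ j : Fin N, Real.cos (t * gridAngle N j) = ((ζ ^ t) ^ (j : ℕ)).re := fun j => by
    rw [hζdef, ← Complex.exp_int_mul, ← Complex.exp_nat_mul,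
      show ((j : ℕ) : ℂ) * ((t : ℂ) * (2 * Real.pi * Complex.I / N)) =
        ((t * gridAngle N j : ℝ) : ℂ) * Complex.I by
        simp only [gridAngle]; push_cast; ring, Complex.exp_ofReal_mul_I_re]
  simp_rw [h4]
  rw [Fin.sum_univ_eq_sum_range (fun j => ((ζ ^ t) ^ j).re) N, ← Complex.re_sum, h3, Complex.zero_re]

theorem avg_cos_gridAngle {N : ℕ} {t : ℤ} (ht : t.natAbs < N) :
    (N : ℝ)⁻¹ * ∑ j : Fin N, Real.cos (t * gridAngle N j) = if t = 0 then 1 else 0 := by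
  have hN : N ≠ 0 := by omega
  split_ifs with h
  · have : (N : ℝ) ≠ 0 := by exact_mod_cast hN
    subst h; simp [this]
  · rw [sum_cos_gridAngle hN, mul_zero]
    intro hd
    exact absurd (Nat.le_of_dvd (by omega) (Int.natCast_dvd.1 hd)) (by omega)

theorem avg_cos_mul_cos_gridAngle {N p : ℕ} {s : ℤ} (h : p + s.natAbs < N) :
    (N : ℝ)⁻¹ * ∑ j : Fin N, Real.cos (p * gridAngle N j) * Real.cos (s * gridAngle N j) =
      ((if s = p then 1 else 0) + (if s = -p then 1 else 0)) / 2 := by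
  have h1 := avg_cos_gridAngle (N := N) (t := s - p) (by omega)
  have h2 := avg_cos_gridAngle (N := N) (t := s + p) (by omega)
  have e1 : (s - (p : ℤ) = 0) = (s = p) := by rw [sub_eq_zero]
  have e2 : (s + (p : ℤ) = 0) = (s = -p) := by rw [eq_neg_iff_add_eq_zero]
  simp only [e1] at h1
  simp only [e2] at h2
  rw [← h1, ← h2, ← mul_add, ← Finset.sum_add_distrib, mul_div_assoc, Finset.sum_div]
  congr 1
  refine Finset.sum_congr rfl fun j _ => ?_
  push_cast
  rw [sub_mul, add_mul, Real.cos_sub, Real.cos_add]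
  ring

end DiscreteOrthogonality

/-! ### Eigenvalues of the kernel and the choice of weights -/

section KernelEigenvalues

open Polynomial
open Polynomial.Chebyshev hiding C

/-- The eigenvalue of the Chebyshev kernel on `T_p`. -/
def kernelEigenvalue (a : ℕ → ℝ) (m p : ℕ) : ℝ :=
  ∑ k ∈ Finset.range m, ∑ l ∈ Finset.range m, if (k : ℤ) - l = p then a k * a l else 0

/-- Averaging against `cos pφ` keeps only the pairs with `k - l = ±p`, each with weight one half.
Since `T_{-p} = T_p`, exchanging `k` and `l` identifies the two halves. The quadrature is exact
because `p + |k - l| < N`. -/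
theorem avg_cos_mul_chebyshevKernel (a : ℕ → ℝ) {m p N : ℕ} (h : p + m ≤ N) :
    ∑ j : Fin N, C ((N : ℝ)⁻¹ * Real.cos (p * gridAngle N j)) *
        chebyshevKernel a m (gridAngle N j) =
      C (kernelEigenvalue a m p) * T ℝ p := by
  have key : ∀ k ∈ Finset.range m, ∀ l ∈ Finset.range m,
      ∑ j : Fin N, C ((N : ℝ)⁻¹ * Real.cos (p * gridAngle N j)) *
        (C (a k * a l * Real.cos (((k - l : ℤ) : ℝ) * gridAngle N j)) * T ℝ (k - l)) =
      C ((if (k : ℤ) - l = p then a k * a l else 0) / 2) * T ℝ p +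
      C ((if (l : ℤ) - k = p then a l * a k else 0) / 2) * T ℝ p := by
    intro k hk l hl
    rw [Finset.mem_range] at hk hl
    have h1 := avg_cos_mul_cos_gridAngle (N := N) (p := p) (s := (k : ℤ) - l) (by omega)
    have e2 : ((k : ℤ) - l = -p) = ((l : ℤ) - k = p) := by
      apply propext; constructor <;> intro h <;> omega
    simp only [e2] at h1
    calc _ = C (a k * a l * ((N : ℝ)⁻¹ * ∑ j : Fin N, Real.cos (p * gridAngle N j) *
              Real.cos (((k - l : ℤ) : ℝ) * gridAngle N j))) * T ℝ (k - l) := by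
            rw [Finset.mul_sum, Finset.mul_sum, map_sum, Finset.sum_mul]
            refine Finset.sum_congr rfl fun j _ => ?_
            simp only [map_mul]; ring
      _ = _ := by
            rw [h1]
            by_cases c1 : (k : ℤ) - l = p
            · by_cases c2 : (l : ℤ) - k = p
              · simp only [c1, c2, if_true]
                rw [← add_mul, ← map_add]; congr 2; ring
              · simp only [c1, c2, if_true, if_false]
                simp only [add_zero, zero_div, map_zero, zero_mul]
                congr 2; ring
            · by_cases c2 : (l : ℤ) - k = p
              · rw [show (k : ℤ) - l = -p by omega, T_neg]
                have c3 : ¬ (-(p : ℤ) = p) := by omega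
                simp only [c2, c3, if_true, if_false]
                simp only [zero_add, zero_div, map_zero, zero_mul]
                congr 2; ring
              · simp only [c1, c2, if_false]; simp
  calc _ = ∑ k ∈ Finset.range m, ∑ l ∈ Finset.range m,
      ∑ j : Fin N, C ((N : ℝ)⁻¹ * Real.cos (p * gridAngle N j)) *
        (C (a k * a l * Real.cos (((k - l : ℤ) : ℝ) * gridAngle N j)) * T ℝ (k - l)) := by
        simp only [chebyshevKernel, Finset.mul_sum]
        rw [Finset.sum_comm]
        exact Finset.sum_congr rfl fun k _ => Finset.sum_comm
    _ = ∑ k ∈ Finset.range m, ∑ l ∈ Finset.range m,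
      (C ((if (k : ℤ) - l = p then a k * a l else 0) / 2) * T ℝ p +
      C ((if (l : ℤ) - k = p then a l * a k else 0) / 2) * T ℝ p) :=
        Finset.sum_congr rfl fun k hk => Finset.sum_congr rfl fun l hl => key k hk l hl
    _ = _ := by
        simp only [Finset.sum_add_distrib]
        rw [Finset.sum_comm (f := fun k l : ℕ =>
          C ((if (l : ℤ) - k = p then a l * a k else 0) / 2) * T ℝ p)]
        simp only [kernelEigenvalue, ← Finset.sum_mul, ← map_sum, ← Finset.sum_div]
        rw [← add_mul, ← map_add, add_halves]

theorem kernelEigenvalue_eq (a : ℕ → ℝ) {m p : ℕ} (hp : p ≤ m) :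
    kernelEigenvalue a m p = ∑ l ∈ Finset.range (m - p), a (p + l) * a l := by
  rw [kernelEigenvalue, Finset.sum_comm]
  have h1 : ∀ l : ℕ, ∑ k ∈ Finset.range m, (if (k : ℤ) - l = p then a k * a l else 0) =
      if l < m - p then a (p + l) * a l else 0 := fun l => by
    have : ∀ k : ℕ, ((k : ℤ) - l = p) ↔ (k = p + l) := fun k => by omega
    simp only [this, Finset.sum_ite_eq', Finset.mem_range]
    congr 1
    exact propext (by omega)
  simp only [h1]
  rw [← Finset.sum_filter]
  refine Finset.sum_congr ?_ fun _ _ => rfl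
  ext l; simp; omega

/-- A tent function on `{0, …, 2 q}`. -/
def tent (q k : ℕ) : ℝ := q - |(k : ℝ) - q|

theorem abs_tent_sub_le (q k p : ℕ) : |tent q (p + k) - tent q k| ≤ p := by
  have h := abs_abs_sub_abs_le_abs_sub ((k : ℝ) - q) (((p + k : ℕ) : ℝ) - q)
  have h2 : |((k : ℝ) - q) - (((p + k : ℕ) : ℝ) - q)| = p := by
    push_cast; rw [abs_sub_comm]; ring_nf; exact abs_of_nonneg (by positivity)
  rw [h2] at h
  simpa [tent] using h

theorem sum_tent_sq_ge (q : ℕ) : (q : ℝ) ^ 3 / 3 ≤ ∑ k ∈ Finset.range (2 * q + 1), tent q k ^ 2 := by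
  have h1 : ∀ q : ℕ, (q : ℝ) ^ 3 / 3 ≤ ∑ k ∈ Finset.range (q + 1), (k : ℝ) ^ 2 := fun q => by
    induction q with
    | zero => simp
    | succ q ih => rw [Finset.sum_range_succ]; push_cast; nlinarith [(Nat.cast_nonneg q : (0 : ℝ) ≤ q)]
  refine (h1 q).trans ?_
  -- The rising half of the tent, where its value is `k`, already suffices.
  calc ∑ k ∈ Finset.range (q + 1), (k : ℝ) ^ 2 = ∑ k ∈ Finset.range (q + 1), tent q k ^ 2 := by
        refine Finset.sum_congr rfl fun k hk => ?_
        have : (k : ℝ) ≤ q := by exact_mod_cast Nat.lt_succ_iff.1 (Finset.mem_range.1 hk)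
        rw [tent, abs_of_nonpos (by linarith)]; ring
    _ ≤ _ := Finset.sum_le_sum_of_subset_of_nonneg (Finset.range_mono (by omega))
        fun _ _ _ => sq_nonneg _

/-- The eigenvalue is the autocorrelation of the weights at lag `p`. Twice its defect from `A` is a
sum of squares: the shift differences, at most `p` because the tent has slope `±1`, and the `p`
values at each end, also at most `p`. -/
theorem kernelEigenvalue_tent_bounds {q p : ℕ} (hpq : p ≤ q) :
    let A := ∑ k ∈ Finset.range (2 * q + 1), tent q k ^ 2
    kernelEigenvalue (tent q) (2 * q + 1) p ≤ A ∧
      A - kernelEigenvalue (tent q) (2 * q + 1) p ≤ 2 * q * p ^ 2 := by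
  intro A
  rcases Nat.eq_zero_or_pos q with rfl | hq0
  · obtain rfl : p = 0 := by omega
    simp [A, kernelEigenvalue, tent]
  have hm : 2 * q + 1 = p + (2 * q + 1 - p) := by omega
  have hm' : 2 * q + 1 = (2 * q + 1 - p) + p := by omega
  have hA1 : A = ∑ l ∈ Finset.range p, tent q l ^ 2 +
      ∑ l ∈ Finset.range (2 * q + 1 - p), tent q (p + l) ^ 2 := by
    simp only [A]; conv_lhs => rw [hm]
    exact Finset.sum_range_add _ _ _
  have hA2 : A = ∑ l ∈ Finset.range (2 * q + 1 - p), tent q l ^ 2 +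
      ∑ l ∈ Finset.range p, tent q (2 * q + 1 - p + l) ^ 2 := by
    simp only [A]; conv_lhs => rw [hm']
    exact Finset.sum_range_add _ _ _
  rw [kernelEigenvalue_eq _ (by omega)]
  have hD : 2 * (A - ∑ l ∈ Finset.range (2 * q + 1 - p), tent q (p + l) * tent q l) =
      ∑ l ∈ Finset.range p, tent q l ^ 2 + ∑ l ∈ Finset.range p, tent q (2 * q + 1 - p + l) ^ 2 +
      ∑ l ∈ Finset.range (2 * q + 1 - p), (tent q (p + l) - tent q l) ^ 2 := by
    have : ∑ l ∈ Finset.range (2 * q + 1 - p), (tent q (p + l) - tent q l) ^ 2 =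
        ∑ l ∈ Finset.range (2 * q + 1 - p), tent q (p + l) ^ 2 +
        ∑ l ∈ Finset.range (2 * q + 1 - p), tent q l ^ 2 -
        2 * ∑ l ∈ Finset.range (2 * q + 1 - p), tent q (p + l) * tent q l := by
      rw [Finset.mul_sum, ← Finset.sum_add_distrib, ← Finset.sum_sub_distrib]
      exact Finset.sum_congr rfl fun _ _ => by ring
    rw [this]; linarith
  constructor
  · have : 0 ≤ 2 * (A - ∑ l ∈ Finset.range (2 * q + 1 - p), tent q (p + l) * tent q l) := by
      rw [hD]; positivity
    linarith
  · have b1 : ∑ l ∈ Finset.range p, tent q l ^ 2 ≤ p * (p : ℝ) ^ 2 := by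
      refine (Finset.sum_le_card_nsmul _ _ ((p : ℝ) ^ 2) fun l hl => ?_).trans (by simp)
      have h : (l : ℝ) ≤ p := by exact_mod_cast (Finset.mem_range.1 hl).le
      have h' : (p : ℝ) ≤ q := by exact_mod_cast hpq
      rw [tent, abs_of_nonpos (by linarith)]
      exact pow_le_pow_left₀ (by ring_nf; positivity) (by linarith) 2
    have b2 : ∑ l ∈ Finset.range p, tent q (2 * q + 1 - p + l) ^ 2 ≤ p * (p : ℝ) ^ 2 := by
      refine (Finset.sum_le_card_nsmul _ _ ((p : ℝ) ^ 2) fun l hl => ?_).trans (by simp)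
      have h : (l : ℝ) + 1 ≤ p := by exact_mod_cast (Finset.mem_range.1 hl)
      have h' : (p : ℝ) ≤ q := by exact_mod_cast hpq
      have h0 : (0 : ℝ) ≤ l := Nat.cast_nonneg l
      rw [tent]
      push_cast [Nat.cast_sub (show p ≤ 2 * q + 1 by omega)]
      rw [abs_of_nonneg (by linarith)]
      exact pow_le_pow_left₀ (by linarith) (by linarith) 2
    have b3 : ∑ l ∈ Finset.range (2 * q + 1 - p), (tent q (p + l) - tent q l) ^ 2 ≤
        ((2 * q + 1 - p : ℕ) : ℝ) * (p : ℝ) ^ 2 := by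
      refine (Finset.sum_le_card_nsmul _ _ ((p : ℝ) ^ 2) fun l _ => ?_).trans (by simp)
      exact sq_le_sq' (by linarith [abs_le.1 (abs_tent_sub_le q l p)])
        (abs_le.1 (abs_tent_sub_le q l p)).2
    have b4 : (p : ℝ) * p ^ 2 + p * p ^ 2 + ((2 * q + 1 - p : ℕ) : ℝ) * (p : ℝ) ^ 2 ≤
        2 * (2 * q * p ^ 2) := by
      rw [← add_mul, ← add_mul, ← mul_assoc]
      refine mul_le_mul_of_nonneg_right ?_ (sq_nonneg _)
      -- There are `2q + 1 + p` squares in all; this is at most `4q` because `p ≤ q` and `q` is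
      -- positive.
      have : p + p + (2 * q + 1 - p) ≤ 2 * (2 * q) := by omega
      exact_mod_cast this
    linarith

/-- There are nonnegative kernels of degree `4 q` whose low eigenvalues are close to `1`. -/
theorem exists_kernel_weights {q : ℕ} (hq : 1 ≤ q) :
    ∃ a : ℕ → ℝ, ∀ p ≤ q, kernelEigenvalue a (2 * q + 1) p ≤ 1 ∧
      1 - kernelEigenvalue a (2 * q + 1) p ≤ 6 * p ^ 2 / q ^ 2 := by
  set A := ∑ k ∈ Finset.range (2 * q + 1), tent q k ^ 2 with hA
  have hq' : (0 : ℝ) < q := by exact_mod_cast hq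
  have hAge : (q : ℝ) ^ 3 / 3 ≤ A := sum_tent_sq_ge q
  have hA0 : 0 < A := lt_of_lt_of_le (by positivity) hAge
  -- `A` is the eigenvalue at `p = 0`, so this normalisation makes that eigenvalue `1`.
  refine ⟨fun k => tent q k / √A, fun p hp => ?_⟩
  have hs : kernelEigenvalue (fun k => tent q k / √A) (2 * q + 1) p =
      kernelEigenvalue (tent q) (2 * q + 1) p / A := by
    simp only [kernelEigenvalue, Finset.sum_div]
    refine Finset.sum_congr rfl fun k _ => Finset.sum_congr rfl fun l _ => ?_
    split_ifs
    · rw [div_mul_div_comm, Real.mul_self_sqrt hA0.le]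
    · simp
  obtain ⟨h1, h2⟩ := kernelEigenvalue_tent_bounds hp
  rw [← hA] at h1 h2
  rw [hs]
  refine ⟨div_le_one_of_le₀ h1 hA0.le, ?_⟩
  rw [one_sub_div hA0.ne', div_le_div_iff₀ hA0 (by positivity)]
  calc _ ≤ 2 * q * (p : ℝ) ^ 2 * q ^ 2 := by gcongr
    _ = 6 * (p : ℝ) ^ 2 * (q ^ 3 / 3) := by ring
    _ ≤ _ := by gcongr

end KernelEigenvalues

/-! ### Closure properties of the truncated cones -/

section Cones

open MvPolynomial

variable {n m : ℕ}

theorem isSumSq_C {σ : Type*} {w : ℝ} (hw : 0 ≤ w) : IsSumSq (C w : MvPolynomial σ ℝ) := by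
  rw [← Real.mul_self_sqrt hw, C_mul]
  exact IsSumSq.mul_self _

theorem IsSumSq.map_ringHom {R S : Type*} [CommSemiring R] [CommSemiring S] (φ : R →+* S) {s : R}
    (hs : IsSumSq s) : IsSumSq (φ s) := by
  induction hs with
  | zero => simp
  | sq_add a _ ih => rw [map_add, map_mul]; exact (IsSumSq.mul_self _).add ih

theorem truncatedPreordering_sum_mem {ι : Type*} (s : Finset ι) (g : Fin m → MvPolynomial (Fin n) ℝ)
    {r : ℕ} {p : ι → MvPolynomial (Fin n) ℝ} (h : ∀ i ∈ s, p i ∈ truncatedPreordering g r) :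
    ∑ i ∈ s, p i ∈ truncatedPreordering g r := by
  choose! σ h1 h2 h3 using h
  refine ⟨fun I => ∑ i ∈ s, σ i I, fun I => IsSumSq.sum fun i hi => h1 i hi I, fun I => ?_, ?_⟩
  · simp only [Finset.sum_mul]
    exact totalDegree_finsetSum_le fun i hi => h2 i hi I
  · simp only [Finset.sum_mul]
    rw [Finset.sum_comm]
    exact Finset.sum_congr rfl h3

theorem truncatedQuadraticModule_add_mem (g : Fin m → MvPolynomial (Fin n) ℝ) {r : ℕ}
    {p q : MvPolynomial (Fin n) ℝ} (hp : p ∈ truncatedQuadraticModule g r)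
    (hq : q ∈ truncatedQuadraticModule g r) : p + q ∈ truncatedQuadraticModule g r := by
  obtain ⟨a₀, a, h1, h2, h3, h4, rfl⟩ := hp
  obtain ⟨b₀, b, k1, k2, k3, k4, rfl⟩ := hq
  refine ⟨a₀ + b₀, fun i => a i + b i, h1.add k1, fun i => (h2 i).add (k2 i),
    (totalDegree_add _ _).trans (max_le h3 k3), fun i => ?_, ?_⟩
  · rw [add_mul]; exact (totalDegree_add _ _).trans (max_le (h4 i) (k4 i))
  · simp only [add_mul, Finset.sum_add_distrib]; ring

theorem zero_mem_truncatedQuadraticModule (g : Fin m → MvPolynomial (Fin n) ℝ) (r : ℕ) :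
    0 ∈ truncatedQuadraticModule g r :=
  ⟨0, 0, .zero, fun _ => .zero, by simp, by simp, by simp⟩

theorem truncatedQuadraticModule_sum_mem {ι : Type*} (s : Finset ι)
    (g : Fin m → MvPolynomial (Fin n) ℝ)
    {r : ℕ} {p : ι → MvPolynomial (Fin n) ℝ} (h : ∀ i ∈ s, p i ∈ truncatedQuadraticModule g r) :
    ∑ i ∈ s, p i ∈ truncatedQuadraticModule g r :=
  Finset.sum_induction p (· ∈ truncatedQuadraticModule g r)
    (fun _ _ => truncatedQuadraticModule_add_mem g) (zero_mem_truncatedQuadraticModule g r) h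

theorem truncatedQuadraticModule_mono (g : Fin m → MvPolynomial (Fin n) ℝ) {r s : ℕ} (h : r ≤ s) :
    truncatedQuadraticModule g r ⊆ truncatedQuadraticModule g s := by
  rintro p ⟨a₀, a, h1, h2, h3, h4, rfl⟩
  exact ⟨a₀, a, h1, h2, h3.trans h, fun i => (h4 i).trans h, rfl⟩

theorem totalDegree_cubeConstraint (i : Fin n) : (cubeConstraint n i).totalDegree = 2 := by
  rw [cubeConstraint, sub_eq_add_neg, totalDegree_add_eq_right_of_totalDegree_lt] <;>
    simp [totalDegree_neg, totalDegree_X_pow]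

theorem cubeConstraint_ne_zero (i : Fin n) : cubeConstraint n i ≠ 0 := fun h => by
  simpa [h] using totalDegree_cubeConstraint i

theorem totalDegree_aeval_X_le (i : Fin n) (p : Polynomial ℝ) :
    (Polynomial.aeval (X i : MvPolynomial (Fin n) ℝ) p).totalDegree ≤ p.natDegree := by
  rw [Polynomial.aeval_eq_sum_range]
  refine totalDegree_finsetSum_le fun k hk => (totalDegree_smul_le _ _).trans ?_
  rw [totalDegree_X_pow]
  exact Nat.lt_succ_iff.1 (Finset.mem_range.1 hk)

/-- Expanding the product, `I` records the factors from which the `Q`-term is taken; every factor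
costs at most `e` degrees whichever term is chosen. -/
theorem prod_mem_truncatedPreordering {e : ℕ} {w : ℝ} (hw : 0 ≤ w)
    (P Q : Fin n → MvPolynomial (Fin n) ℝ) (hP : ∀ i, IsSumSq (P i)) (hQ : ∀ i, IsSumSq (Q i))
    (hPd : ∀ i, (P i).totalDegree ≤ e) (hQd : ∀ i, (Q i).totalDegree + 2 ≤ e) :
    C w * ∏ i, (P i + Q i * cubeConstraint n i) ∈
      truncatedPreordering (cubeConstraint n) (e * n) := by
  refine ⟨fun I => C w * ((∏ i ∈ I, Q i) * ∏ i ∈ Finset.univ \ I, P i), fun I => ?_, fun I => ?_, ?_⟩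
  · exact (isSumSq_C hw).mul ((IsSumSq.prod fun i _ => hQ i).mul (IsSumSq.prod fun i _ => hP i))
  · have : C w * ((∏ i ∈ I, Q i) * ∏ i ∈ Finset.univ \ I, P i) * ∏ i ∈ I, cubeConstraint n i =
        C w * ((∏ i ∈ I, Q i * cubeConstraint n i) * ∏ i ∈ Finset.univ \ I, P i) := by
      rw [Finset.prod_mul_distrib]; ring
    rw [this]
    refine (totalDegree_mul _ _).trans ?_
    rw [totalDegree_C, zero_add]
    refine (totalDegree_mul _ _).trans ?_
    have h1 : (∏ i ∈ I, Q i * cubeConstraint n i).totalDegree ≤ I.card * e := by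
      refine (totalDegree_finsetProd _ _).trans (Finset.sum_le_card_nsmul _ _ e fun i _ => ?_)
      refine (totalDegree_mul _ _).trans ?_
      rw [totalDegree_cubeConstraint]; exact hQd i
    have h2 : (∏ i ∈ Finset.univ \ I, P i).totalDegree ≤ (Finset.univ \ I).card * e :=
      (totalDegree_finsetProd _ _).trans (Finset.sum_le_card_nsmul _ _ e fun i _ => hPd i)
    have h3 : I.card + (Finset.univ \ I).card = n := by
      rw [← Finset.compl_eq_univ_sdiff, Finset.card_add_card_compl, Fintype.card_fin]
    calc _ ≤ I.card * e + (Finset.univ \ I).card * e := add_le_add h1 h2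
      _ = e * n := by rw [← add_mul, h3, mul_comm]
  · simp only [add_comm (P _)]
    rw [Finset.prod_add, Finset.mul_sum, Finset.powerset_univ]
    refine Finset.sum_congr rfl fun I _ => ?_
    rw [Finset.prod_mul_distrib]; ring

end Cones

/-! ### Expansion in tensor Chebyshev polynomials and coefficient bounds -/

section ChebyshevExpansion

open MvPolynomial
open Polynomial.Chebyshev (T T_real_cos)

variable {n : ℕ}

/-- The tensor product Chebyshev polynomial `∏ i, T_{α i}(x_i)`. -/
def tensorChebyshev (α : Fin n → ℕ) : MvPolynomial (Fin n) ℝ :=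
  ∏ i, Polynomial.aeval (X i) (T ℝ (α i))

/-- The multi-indices of total degree at most `d`. -/
def multiIndices (n d : ℕ) : Finset (Fin n → ℕ) :=
  (Fintype.piFinset fun _ => Finset.range (d + 1)).filter fun α => ∑ i, α i ≤ d

theorem mem_multiIndices {d : ℕ} {α : Fin n → ℕ} : α ∈ multiIndices n d ↔ ∑ i, α i ≤ d := by
  simp only [multiIndices, Finset.mem_filter, Fintype.mem_piFinset, Finset.mem_range,
    and_iff_right_iff_imp]
  exact fun h i => Nat.lt_succ_iff.2
    ((Finset.single_le_sum (f := α) (fun _ _ => Nat.zero_le _) (Finset.mem_univ i)).trans h)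

theorem card_multiIndices_le_pow (n d : ℕ) : (multiIndices n d).card ≤ (d + 1) ^ n := by
  refine (Finset.card_filter_le _ _).trans ?_
  simp

/-- An index of weight `d + 1` is one of weight `d` plus a unit vector, so raising `d` by one
multiplies the count by at most `n + 1`. This bound is polynomial in `n`, the previous one in `d`.
-/
theorem card_multiIndices_le_pow' (n d : ℕ) : (multiIndices n d).card ≤ (n + 1) ^ d := by
  induction d with
  | zero =>
    rw [pow_zero, Finset.card_le_one]
    intro α hα β hβ
    simp only [mem_multiIndices, Nat.le_zero, Finset.sum_eq_zero_iff, Finset.mem_univ,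
      true_implies] at hα hβ
    ext i; rw [hα i, hβ i]
  | succ d ih =>
    have hsub : multiIndices n (d + 1) ⊆ multiIndices n d ∪
        (Finset.univ : Finset (Fin n)).biUnion fun i =>
          (multiIndices n d).image fun α => α + Pi.single i 1 := by
      intro α hα
      rw [mem_multiIndices] at hα
      rw [Finset.mem_union]
      by_cases h : ∑ i, α i ≤ d
      · exact .inl (mem_multiIndices.2 h)
      · right
        obtain ⟨i, hi⟩ : ∃ i, α i ≠ 0 := by
          by_contra! h0
          simp [h0] at h
        have hle : (Pi.single i 1 : Fin n → ℕ) ≤ α := by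
          intro j
          rcases eq_or_ne j i with rfl | hj
          · simpa using Nat.one_le_iff_ne_zero.2 hi
          · simp [hj]
        simp only [Finset.mem_biUnion, Finset.mem_univ, true_and, Finset.mem_image]
        refine ⟨i, α - Pi.single i 1, ?_, tsub_add_cancel_of_le hle⟩
        rw [mem_multiIndices]
        have := congrArg (fun β : Fin n → ℕ => ∑ j, β j) (tsub_add_cancel_of_le hle)
        simp only [Pi.add_apply, Finset.sum_add_distrib, Finset.sum_pi_single', Finset.mem_univ,
          if_true] at this
        omega
    calc (multiIndices n (d + 1)).card ≤ _ := Finset.card_le_card hsub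
      _ ≤ (multiIndices n d).card + n * (multiIndices n d).card := by
        refine (Finset.card_union_le _ _).trans (Nat.add_le_add_left ?_ _)
        refine (Finset.card_biUnion_le_card_mul _ _ (multiIndices n d).card
          fun i _ => Finset.card_image_le).trans (by simp)
      _ = (n + 1) * (multiIndices n d).card := by ring
      _ ≤ (n + 1) * (n + 1) ^ d := Nat.mul_le_mul_left _ ih
      _ = _ := by ring

theorem prod_update_eq {R : Type*} [CommMonoid R] (F : Fin n → ℕ → R) (α : Fin n → ℕ)
    (i : Fin n) (b : ℕ) :
    ∏ j, F j (Function.update α i b j) = F i b * ∏ j ∈ Finset.univ.erase i, F j (α j) := by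
  rw [← Finset.mul_prod_erase _ _ (Finset.mem_univ i), Function.update_self]
  congr 1
  exact Finset.prod_congr rfl fun j hj => by rw [Function.update_of_ne (Finset.ne_of_mem_erase hj)]

/-- The span of the tensor product Chebyshev polynomials of degree at most `d`. -/
def chebyshevSpan (n d : ℕ) : Submodule ℝ (MvPolynomial (Fin n) ℝ) :=
  Submodule.span ℝ (tensorChebyshev '' (multiIndices n d : Set (Fin n → ℕ)))

theorem tensorChebyshev_mem_span {d : ℕ} {α : Fin n → ℕ} (h : ∑ i, α i ≤ d) :
    tensorChebyshev α ∈ chebyshevSpan n d :=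
  Submodule.subset_span ⟨α, mem_multiIndices.2 h, rfl⟩

/-- The recurrence `2 x T_k = T_{k+1} + T_{k-1}` in one variable; the absolute value covers `k = 0`
through `T_{-1} = T_1`. -/
theorem X_mul_tensorChebyshev (α : Fin n → ℕ) (i : Fin n) :
    X i * tensorChebyshev α = (1 / 2 : ℝ) • (tensorChebyshev (Function.update α i (α i + 1)) +
      tensorChebyshev (Function.update α i ((α i : ℤ) - 1).natAbs)) := by
  have h0 : tensorChebyshev α = tensorChebyshev (Function.update α i (α i)) := by
    rw [Function.update_eq_self]
  rw [h0]
  simp only [tensorChebyshev]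
  rw [prod_update_eq (fun j k => Polynomial.aeval (X j) (T ℝ (k : ℤ))),
    prod_update_eq (fun j k => Polynomial.aeval (X j) (T ℝ (k : ℤ))),
    prod_update_eq (fun j k => Polynomial.aeval (X j) (T ℝ (k : ℤ))), ← add_mul,
    Polynomial.Chebyshev.T_natAbs, ← map_add, ← mul_assoc, ← smul_mul_assoc]
  congr 1
  push_cast
  rw [Polynomial.Chebyshev.T_add_one, sub_add_cancel, ← map_smul,
    show (1 / 2 : ℝ) • (2 * Polynomial.X * T ℝ (α i)) = Polynomial.X * T ℝ (α i) by
      rw [mul_assoc, ← two_smul ℝ (Polynomial.X * T ℝ (α i) : Polynomial ℝ) |>.trans (two_mul _).symm,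
        smul_smul]
      norm_num,
    map_mul, Polynomial.aeval_X]

theorem X_mul_mem_chebyshevSpan {d : ℕ} (i : Fin n) {p : MvPolynomial (Fin n) ℝ}
    (hp : p ∈ chebyshevSpan n d) : X i * p ∈ chebyshevSpan n (d + 1) := by
  induction hp using Submodule.span_induction with
  | mem x hx =>
    obtain ⟨α, hα, rfl⟩ := hx
    have hα : ∑ i, α i ≤ d := mem_multiIndices.1 hα
    rw [X_mul_tensorChebyshev]
    have hsum : ∀ b, b ≤ α i + 1 → ∑ j, Function.update α i b j ≤ d + 1 := fun b hb => by
      rw [Finset.sum_update_of_mem (Finset.mem_univ i)]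
      rw [← Finset.add_sum_erase _ _ (Finset.mem_univ i)] at hα
      rw [← Finset.erase_eq]
      omega
    exact Submodule.smul_mem _ _ (Submodule.add_mem _ (tensorChebyshev_mem_span (hsum _ le_rfl))
      (tensorChebyshev_mem_span (hsum _ (by omega))))
  | zero => simp
  | add x y _ _ hx hy => rw [mul_add]; exact Submodule.add_mem _ hx hy
  | smul a x _ hx => rw [mul_smul_comm]; exact Submodule.smul_mem _ _ hx

theorem chebyshevSpan_mono {d e : ℕ} (h : d ≤ e) : chebyshevSpan n d ≤ chebyshevSpan n e :=
  Submodule.span_mono (Set.image_mono fun _ hα =>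
    mem_multiIndices.2 ((mem_multiIndices.1 (Finset.mem_coe.1 hα)).trans h))

theorem monomial_mem_chebyshevSpan (d : ℕ) :
    ∀ s : Fin n →₀ ℕ, s.degree = d → monomial s (1 : ℝ) ∈ chebyshevSpan n d := by
  induction d with
  | zero =>
    intro s hs
    rw [Finsupp.degree_eq_zero_iff] at hs
    subst hs
    have : monomial (0 : Fin n →₀ ℕ) (1 : ℝ) = tensorChebyshev 0 := by simp [tensorChebyshev]
    rw [this]
    exact tensorChebyshev_mem_span (by simp)
  | succ d ih =>
    intro s hs
    obtain ⟨i, hi⟩ : ∃ i, s i ≠ 0 := by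
      by_contra! h0
      have : s = 0 := Finsupp.ext h0
      simp [this] at hs
    have hle : Finsupp.single i 1 ≤ s := by
      rw [Finsupp.single_le_iff]; omega
    have hs' := tsub_add_cancel_of_le hle
    have h2 : monomial s (1 : ℝ) = X i * monomial (s - Finsupp.single i 1) 1 := by
      rw [X, monomial_mul, add_comm, hs', one_mul]
    rw [h2]
    refine X_mul_mem_chebyshevSpan i (ih _ ?_)
    have := congrArg Finsupp.degree hs'
    rw [map_add, Finsupp.degree_single, hs] at this
    omega

theorem exists_chebyshev_coeffs {d : ℕ} {f : MvPolynomial (Fin n) ℝ} (hf : f.totalDegree ≤ d) :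
    ∃ c : (Fin n → ℕ) → ℝ, f = ∑ α ∈ multiIndices n d, C (c α) * tensorChebyshev α := by
  have hmem : f ∈ chebyshevSpan n d := by
    rw [f.as_sum]
    refine Submodule.sum_mem _ fun s hs => ?_
    have h1 : monomial s (coeff s f) = coeff s f • monomial s (1 : ℝ) := by
      rw [smul_monomial, smul_eq_mul, mul_one]
    rw [h1]
    refine Submodule.smul_mem _ _ (chebyshevSpan_mono ?_ (monomial_mem_chebyshevSpan _ s rfl))
    exact (le_totalDegree hs).trans hf
  rw [chebyshevSpan, Submodule.mem_span_image_finset_iff_exists_fun] at hmem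
  obtain ⟨c, hc⟩ := hmem
  refine ⟨fun α => if h : α ∈ multiIndices n d then c ⟨α, h⟩ else 0, ?_⟩
  refine hc.symm.trans (Eq.trans ?_ (Finset.sum_coe_sort (multiIndices n d) _))
  exact Finset.sum_congr rfl fun α _ => by simp only [α.2, dite_true, C_mul']

theorem sum_prod_grid {R : Type*} [CommSemiring R] {N : ℕ} (G : Fin n → Fin N → R) :
    ∑ y : Fin n → Fin N, ∏ i, G i (y i) = ∏ i, ∑ j, G i j := by
  rw [Finset.prod_univ_sum, Fintype.piFinset_univ]

/-- The points of the Chebyshev grid in the hypercube. -/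
def gridPoint {N : ℕ} (y : Fin n → Fin N) : Fin n → ℝ := fun i => Real.cos (gridAngle N (y i))

theorem gridPoint_mem_hypercube {N : ℕ} (y : Fin n → Fin N) : gridPoint y ∈ hypercube n :=
  ⟨fun _ => Real.neg_one_le_cos _, fun _ => Real.cos_le_one _⟩

theorem eval_aeval_X (x : Fin n → ℝ) (i : Fin n) (p : Polynomial ℝ) :
    eval x (Polynomial.aeval (X i) p) = p.eval (x i) := by
  rw [← MvPolynomial.coe_aeval_eq_eval, RingHom.coe_coe, ← Polynomial.aeval_algHom_apply]
  simp [Polynomial.aeval_def, Polynomial.eval₂_eq_eval_map]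

theorem eval_tensorChebyshev_gridPoint {N : ℕ} (y : Fin n → Fin N) (α : Fin n → ℕ) :
    eval (gridPoint y) (tensorChebyshev α) = ∏ i, Real.cos (α i * gridAngle N (y i)) := by
  rw [tensorChebyshev, map_prod]
  refine Finset.prod_congr rfl fun i _ => ?_
  rw [eval_aeval_X, gridPoint, T_real_cos]
  push_cast; rfl

theorem abs_eval_tensorChebyshev_gridPoint_le {N : ℕ} (y : Fin n → Fin N) (α : Fin n → ℕ) :
    |eval (gridPoint y) (tensorChebyshev α)| ≤ 1 := by
  rw [eval_tensorChebyshev_gridPoint, Finset.abs_prod]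
  exact Finset.prod_le_one (fun _ _ => abs_nonneg _) fun _ _ => Real.abs_cos_le_one _

/-- Averaging over the grid against `∏ cos(α_i θ_i)` isolates `c α` up to a factor `1/2` for each
nonzero `α_i`. There are at most `min n d` of these, and the average is bounded by `M`. -/
theorem abs_chebyshev_coeff_le {d N : ℕ} (hN : 2 * d < N) {c : (Fin n → ℕ) → ℝ} {M : ℝ}
    (hM : ∀ y : Fin n → Fin N,
      |eval (gridPoint y) (∑ α ∈ multiIndices n d, C (c α) * tensorChebyshev α)| ≤ M)
    {α : Fin n → ℕ} (hα : α ∈ multiIndices n d) :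
    |c α| ≤ 2 ^ min n d * M := by
  have hN0 : (0 : ℝ) < N := by exact_mod_cast (by omega : 0 < N)
  have hle : ∀ β ∈ multiIndices n d, ∀ i, β i ≤ d := fun β hβ i =>
    (Finset.single_le_sum (f := β) (fun _ _ => Nat.zero_le _) (Finset.mem_univ i)).trans
      (mem_multiIndices.1 hβ)
  have key : ∑ y : Fin n → Fin N, (∏ i, (N : ℝ)⁻¹ * Real.cos (α i * gridAngle N (y i))) *
      eval (gridPoint y) (∑ β ∈ multiIndices n d, C (c β) * tensorChebyshev β) =
      c α * ∏ i, if α i = 0 then (1 : ℝ) else 1 / 2 := by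
    simp only [map_sum, map_mul, eval_C, Finset.mul_sum, eval_tensorChebyshev_gridPoint]
    rw [Finset.sum_comm, Finset.sum_eq_single α]
    · simp_rw [mul_left_comm _ (c α), ← Finset.mul_sum, ← Finset.prod_mul_distrib]
      rw [sum_prod_grid (fun i j => (N : ℝ)⁻¹ * Real.cos (α i * gridAngle N j) *
        Real.cos (α i * gridAngle N j))]
      congr 1
      refine Finset.prod_congr rfl fun i _ => ?_
      have h := avg_cos_mul_cos_gridAngle (N := N) (p := α i) (s := α i)
        (by have := hle α hα i; omega)
      simp only [Int.cast_natCast] at h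
      simp only [mul_assoc]
      rw [← Finset.mul_sum, h]
      by_cases h0 : α i = 0
      · simp [h0]
      · have : ¬ ((α i : ℤ) = -(α i : ℤ)) := by omega
        simp [h0, this]
    · intro β hβ hne
      obtain ⟨i, hi⟩ : ∃ i, β i ≠ α i := Function.ne_iff.1 hne
      simp_rw [mul_left_comm _ (c β), ← Finset.mul_sum, ← Finset.prod_mul_distrib]
      rw [sum_prod_grid (fun i j => (N : ℝ)⁻¹ * Real.cos (α i * gridAngle N j) *
        Real.cos (β i * gridAngle N j))]
      rw [Finset.prod_eq_zero (Finset.mem_univ i), mul_zero]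
      have h := avg_cos_mul_cos_gridAngle (N := N) (p := α i) (s := β i)
        (by have := hle α hα i; have := hle β hβ i; omega)
      simp only [Int.cast_natCast] at h
      simp only [mul_assoc]
      rw [← Finset.mul_sum, h]
      have h1 : ¬ ((β i : ℤ) = α i) := by omega
      have h2 : ¬ ((β i : ℤ) = -(α i : ℤ)) := by omega
      simp [h1, h2]
    · exact fun h => absurd hα h
  have hb : |c α * ∏ i, if α i = 0 then (1 : ℝ) else 1 / 2| ≤ M := by
    rw [← key]
    refine (Finset.abs_sum_le_sum_abs _ _).trans ?_
    have hM0 : ∀ y : Fin n → Fin N, |(∏ i, (N : ℝ)⁻¹ * Real.cos (α i * gridAngle N (y i))) *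
      eval (gridPoint y) (∑ β ∈ multiIndices n d, C (c β) * tensorChebyshev β)| ≤
        (∏ _i : Fin n, (N : ℝ)⁻¹) * M := fun y => by
      rw [abs_mul, Finset.abs_prod]
      refine mul_le_mul ?_ (hM y) (abs_nonneg _) (Finset.prod_nonneg fun _ _ => by positivity)
      refine Finset.prod_le_prod (fun _ _ => abs_nonneg _) fun i _ => ?_
      rw [abs_mul, abs_of_pos (inv_pos.2 hN0)]
      exact mul_le_of_le_one_right (by positivity) (Real.abs_cos_le_one _)
    refine (Finset.sum_le_sum fun y _ => hM0 y).trans (le_of_eq ?_)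
    rw [Finset.sum_const, Finset.prod_const, Finset.card_univ, Fintype.card_fun, Fintype.card_fin,
      Fintype.card_fin, Finset.card_univ, Fintype.card_fin, nsmul_eq_mul]
    push_cast
    rw [← mul_assoc, ← mul_pow, mul_inv_cancel₀ hN0.ne', one_pow, one_mul]
  have hw : (1 / 2 : ℝ) ^ min n d ≤ ∏ i, if α i = 0 then (1 : ℝ) else 1 / 2 := by
    rw [Finset.prod_ite, Finset.prod_const_one, one_mul, Finset.prod_const]
    refine pow_le_pow_of_le_one (by norm_num) (by norm_num) (le_min ?_ ?_)
    · exact (Finset.card_le_univ _).trans (by simp)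
    · refine le_trans ?_ (mem_multiIndices.1 hα)
      rw [Finset.card_eq_sum_ones]
      refine (Finset.sum_le_sum (g := α) fun i hi => ?_).trans
        (Finset.sum_le_sum_of_subset (Finset.filter_subset _ _))
      exact Nat.one_le_iff_ne_zero.2 (Finset.mem_filter.1 hi).2
  rw [abs_mul, abs_of_nonneg (le_trans (by positivity) hw)] at hb
  have h3 : |c α| * (1 / 2) ^ min n d ≤ M := (mul_le_mul_of_nonneg_left hw (abs_nonneg _)).trans hb
  calc |c α| = 2 ^ min n d * (|c α| * (1 / 2) ^ min n d) := by
        rw [mul_comm |c α|, ← mul_assoc, ← mul_pow]; norm_num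
    _ ≤ _ := by gcongr

end ChebyshevExpansion

/-! ### The effective Schmüdgen theorem by the kernel method -/

section Schmudgen

open MvPolynomial
open Polynomial.Chebyshev (T)

variable {n : ℕ}

theorem truncatedPreordering_mono {m : ℕ} (g : Fin m → MvPolynomial (Fin n) ℝ) {r s : ℕ}
    (h : r ≤ s) : truncatedPreordering g r ⊆ truncatedPreordering g s := by
  rintro p ⟨σ, h1, h2, h3⟩
  exact ⟨σ, h1, fun I => (h2 I).trans h, h3⟩

theorem one_sub_prod_le_sum_one_sub {ι : Type*} (s : Finset ι) (x : ι → ℝ)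
    (h : ∀ i ∈ s, 0 ≤ x i ∧ x i ≤ 1) : 1 - ∏ i ∈ s, x i ≤ ∑ i ∈ s, (1 - x i) := by
  classical
  induction s using Finset.induction_on with
  | empty => simp
  | insert i s hi ih =>
    rw [Finset.prod_insert hi, Finset.sum_insert hi]
    have h1 := ih fun j hj => h j (Finset.mem_insert_of_mem hj)
    obtain ⟨h2, h3⟩ := h i (Finset.mem_insert_self i s)
    have h4 : ∏ j ∈ s, x j ≤ 1 := Finset.prod_le_one
      (fun j hj => (h j (Finset.mem_insert_of_mem hj)).1)
      fun j hj => (h j (Finset.mem_insert_of_mem hj)).2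
    nlinarith

/-- The reproducing formula for the tensor product Chebyshev kernel on the grid. -/
theorem sum_grid_mul_kernel (a : ℕ → ℝ) {d m N : ℕ} (hN : d + m ≤ N) (b : (Fin n → ℕ) → ℝ) :
    ∑ y : Fin n → Fin N, C ((∏ _i : Fin n, (N : ℝ)⁻¹) *
        eval (gridPoint y) (∑ α ∈ multiIndices n d, C (b α) * tensorChebyshev α)) *
        ∏ i, Polynomial.aeval (X i) (chebyshevKernel a m (gridAngle N (y i))) =
      ∑ α ∈ multiIndices n d,
        C (b α * ∏ i, kernelEigenvalue a m (α i)) * tensorChebyshev α := by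
  -- For a single `α` the sum over the grid factors into `n` univariate averages.
  have hα : ∀ α ∈ multiIndices n d,
      ∑ y : Fin n → Fin N, C ((∏ _i : Fin n, (N : ℝ)⁻¹) *
        ∏ i, Real.cos (α i * gridAngle N (y i))) *
        ∏ i, Polynomial.aeval (X i) (chebyshevKernel a m (gridAngle N (y i))) =
      C (∏ i, kernelEigenvalue a m (α i)) * tensorChebyshev α := by
    intro α hα
    have h1 : ∀ i, ∑ j : Fin N, Polynomial.aeval (X i : MvPolynomial (Fin n) ℝ)
        (Polynomial.C ((N : ℝ)⁻¹ * Real.cos (α i * gridAngle N j)) *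
          chebyshevKernel a m (gridAngle N j)) =
        C (kernelEigenvalue a m (α i)) * Polynomial.aeval (X i) (T ℝ (α i)) := fun i => by
      have hi : α i ≤ d := (Finset.single_le_sum (f := α) (fun _ _ => Nat.zero_le _)
        (Finset.mem_univ i)).trans (mem_multiIndices.1 hα)
      rw [← map_sum, avg_cos_mul_chebyshevKernel a (by omega), map_mul, Polynomial.aeval_C]
      rfl
    simp only [tensorChebyshev]
    rw [map_prod, ← Finset.prod_mul_distrib, ← Finset.prod_congr rfl fun i _ => h1 i,
      ← sum_prod_grid]
    refine Finset.sum_congr rfl fun y _ => ?_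
    rw [← Finset.prod_mul_distrib, map_prod, ← Finset.prod_mul_distrib]
    refine Finset.prod_congr rfl fun i _ => ?_
    rw [map_mul (Polynomial.aeval _), Polynomial.aeval_C]
    rfl
  calc _ = ∑ y : Fin n → Fin N, ∑ α ∈ multiIndices n d, C (b α) *
        (C ((∏ _i : Fin n, (N : ℝ)⁻¹) * ∏ i, Real.cos (α i * gridAngle N (y i))) *
        ∏ i, Polynomial.aeval (X i) (chebyshevKernel a m (gridAngle N (y i)))) := by
        refine Finset.sum_congr rfl fun y _ => ?_
        rw [map_sum, Finset.mul_sum, map_sum, Finset.sum_mul]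
        refine Finset.sum_congr rfl fun α _ => ?_
        simp only [map_mul, eval_C, eval_tensorChebyshev_gridPoint]
        ring
    _ = _ := by
        rw [Finset.sum_comm]
        refine Finset.sum_congr rfl fun α h => ?_
        rw [← Finset.mul_sum, hα α h, C_mul, mul_assoc]

/-- Dividing each coefficient of `f` by its eigenvalue `μ α` changes `f` on the grid by at most
`fmin`, so the result stays nonnegative there. The kernel restores `f` from these values, hence `f`
is a nonnegative combination of products of univariate kernels. -/
theorem mem_truncatedPreordering_of_kernel {d q : ℕ} {f : MvPolynomial (Fin n) ℝ} {fmax fmin : ℝ}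
    (hdeg : f.totalDegree ≤ d) (hpos : 0 < fmin)
    (hf : ∀ x ∈ hypercube n, fmin ≤ eval x f ∧ eval x f ≤ fmax) (hq : 1 ≤ q)
    (hdq : 12 * (d : ℝ) ^ 2 ≤ q ^ 2)
    (hbd : 12 * (d : ℝ) ^ 2 * ((multiIndices n d).card * 2 ^ min n d) * fmax ≤ q ^ 2 * fmin) :
    f ∈ truncatedPreordering (cubeConstraint n) (4 * q * n) := by
  have hq0 : (0 : ℝ) < q := by exact_mod_cast hq
  have hdq' : d ≤ q := by
    have : (d : ℝ) ^ 2 ≤ (q : ℝ) ^ 2 := by nlinarith [sq_nonneg (d : ℝ)]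
    exact_mod_cast (pow_le_pow_iff_left₀ (by positivity) (by positivity) two_ne_zero).1 this
  obtain ⟨a, ha⟩ := exists_kernel_weights hq
  obtain ⟨c, hc⟩ := exists_chebyshev_coeffs hdeg
  -- Large enough both for the coefficient bound, `2d < N`, and for the reproducing formula, `d + m
  -- ≤ N` with `m = 2q + 1`.
  set N := d + d + (2 * q + 1) with hN
  set μ : (Fin n → ℕ) → ℝ := fun α => ∏ i, kernelEigenvalue a (2 * q + 1) (α i) with hμ
  set ε : ℝ := 6 * d ^ 2 / q ^ 2 with hε
  have hε2 : ε ≤ 1 / 2 := by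
    rw [hε, div_le_iff₀ (by positivity)]; linarith
  have hε0 : 0 ≤ ε := by positivity
  have hμb : ∀ α ∈ multiIndices n d, μ α ≤ 1 ∧ 1 - μ α ≤ ε := by
    intro α hα
    have hα' := mem_multiIndices.1 hα
    have hle : ∀ i, α i ≤ d := fun i => (Finset.single_le_sum (f := α) (fun _ _ => Nat.zero_le _)
        (Finset.mem_univ i)).trans hα'
    have hb : ∀ i ∈ Finset.univ, 0 ≤ kernelEigenvalue a (2 * q + 1) (α i) ∧
        kernelEigenvalue a (2 * q + 1) (α i) ≤ 1 := fun i _ => by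
      obtain ⟨h1, h2⟩ := ha (α i) ((hle i).trans hdq')
      have h3 : 6 * (α i : ℝ) ^ 2 / q ^ 2 ≤ ε := by
        have : (α i : ℝ) ≤ d := by exact_mod_cast hle i
        rw [hε]; gcongr
      exact ⟨by linarith, h1⟩
    refine ⟨Finset.prod_le_one (fun i hi => (hb i hi).1) fun i hi => (hb i hi).2, ?_⟩
    refine (one_sub_prod_le_sum_one_sub _ _ hb).trans ?_
    refine (Finset.sum_le_sum fun i _ => (ha (α i) ((hle i).trans hdq')).2).trans ?_
    rw [← Finset.sum_div, ← Finset.mul_sum, hε]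
    gcongr
    -- Bounding by the square of the sum avoids a factor `n` in `ε`.
    calc ∑ i, (α i : ℝ) ^ 2 ≤ (∑ i, (α i : ℝ)) ^ 2 :=
          Finset.sum_sq_le_sq_sum_of_nonneg fun i _ => Nat.cast_nonneg _
      _ ≤ (d : ℝ) ^ 2 := by
          gcongr
          exact_mod_cast hα'
  have hμ0 : ∀ α ∈ multiIndices n d, 0 < μ α := fun α hα => by have := hμb α hα; linarith
  have hfM : ∀ y : Fin n → Fin N, |eval (gridPoint y)
      (∑ α ∈ multiIndices n d, C (c α) * tensorChebyshev α)| ≤ fmax := fun y => by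
    rw [← hc]
    obtain ⟨h1, h2⟩ := hf _ (gridPoint_mem_hypercube y)
    exact abs_le.2 ⟨by linarith, h2⟩
  have hcoef : ∀ α ∈ multiIndices n d, |c α| ≤ 2 ^ min n d * fmax := fun α hα =>
    abs_chebyshev_coeff_le (by omega) hfM hα
  have hnonneg : ∀ y : Fin n → Fin N, 0 ≤ eval (gridPoint y)
      (∑ α ∈ multiIndices n d, C (c α / μ α) * tensorChebyshev α) := by
    intro y
    have h1 : eval (gridPoint y) f - eval (gridPoint y)
        (∑ α ∈ multiIndices n d, C (c α / μ α) * tensorChebyshev α) =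
        ∑ α ∈ multiIndices n d, (c α * ((μ α - 1) / μ α)) *
          eval (gridPoint y) (tensorChebyshev α) := by
      conv_lhs => rw [hc]
      simp only [map_sum, map_mul, eval_C]
      rw [← Finset.sum_sub_distrib]
      refine Finset.sum_congr rfl fun α hα => ?_
      have := (hμ0 α hα).ne'
      field_simp
    have h2 : |∑ α ∈ multiIndices n d, (c α * ((μ α - 1) / μ α)) *
          eval (gridPoint y) (tensorChebyshev α)| ≤
        (multiIndices n d).card * (2 ^ min n d * fmax * (2 * ε)) := by
      refine (Finset.abs_sum_le_sum_abs _ _).trans ?_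
      rw [← nsmul_eq_mul]
      refine Finset.sum_le_card_nsmul _ _ _ fun α hα => ?_
      obtain ⟨k1, k2⟩ := hμb α hα
      have k3 := hμ0 α hα
      rw [abs_mul, abs_mul]
      refine (mul_le_of_le_one_right (by positivity)
        (abs_eval_tensorChebyshev_gridPoint_le y α)).trans ?_
      -- The factor `2` comes from `μ α ≥ 1 - ε ≥ 1/2`.
      have h4 : |(μ α - 1) / μ α| ≤ 2 * ε := by
        rw [abs_div, abs_of_pos k3, abs_of_nonpos (by linarith), div_le_iff₀ k3]
        nlinarith
      exact mul_le_mul (hcoef α hα) h4 (abs_nonneg _) ((abs_nonneg _).trans (hcoef α hα))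
    have h3 : (multiIndices n d).card * (2 ^ min n d * fmax * (2 * ε)) ≤ fmin := by
      rw [hε]
      rw [show (multiIndices n d).card * (2 ^ min n d * fmax * (2 * (6 * (d : ℝ) ^ 2 / q ^ 2))) =
        12 * (d : ℝ) ^ 2 * ((multiIndices n d).card * 2 ^ min n d) * fmax / q ^ 2 by ring,
        div_le_iff₀ (by positivity)]
      linarith
    have h4 := (hf _ (gridPoint_mem_hypercube y)).1
    have h5 := (abs_le.1 h2).2
    linarith
  have hrep := sum_grid_mul_kernel a (n := n) (d := d) (m := 2 * q + 1) (N := N) (by omega)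
    (fun α => c α / μ α)
  have hR : ∑ α ∈ multiIndices n d, C (c α / μ α * ∏ i, kernelEigenvalue a (2 * q + 1) (α i)) *
      tensorChebyshev α = f := by
    conv_rhs => rw [hc]
    refine Finset.sum_congr rfl fun α hα => ?_
    rw [div_mul_cancel₀ _ (hμ0 α hα).ne']
  rw [← hR, ← hrep]
  refine truncatedPreordering_sum_mem _ _ fun y _ => ?_
  choose A B hA hB hAd hBd hAB using fun φ => exists_isSumSq_chebyshevKernel a hq φ
  have hprod : ∏ i, Polynomial.aeval (X i : MvPolynomial (Fin n) ℝ)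
      (chebyshevKernel a (2 * q + 1) (gridAngle N (y i))) =
      ∏ i, (Polynomial.aeval (X i) (A (gridAngle N (y i))) +
        Polynomial.aeval (X i) (B (gridAngle N (y i))) * cubeConstraint n i) := by
    refine Finset.prod_congr rfl fun i _ => ?_
    rw [hAB, cubeConstraint]
    simp
  rw [hprod]
  refine prod_mem_truncatedPreordering (mul_nonneg (Finset.prod_nonneg fun _ _ => by positivity)
    (hnonneg y)) _ _ (fun i => ?_) (fun i => ?_) (fun i => ?_) fun i => ?_
  · exact (hA _).map_ringHom (Polynomial.aeval (X i)).toRingHom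
  · exact (hB _).map_ringHom (Polynomial.aeval (X i)).toRingHom
  · exact (totalDegree_aeval_X_le i _).trans (hAd _)
  · have := (totalDegree_aeval_X_le i _).trans (hBd (gridAngle N (y i)))
    omega

theorem zero_mem_hypercube : (0 : Fin n → ℝ) ∈ hypercube n :=
  ⟨fun _ => by simp, fun _ => by simp⟩

theorem IsPositiveOnCube.le_eval {f : MvPolynomial (Fin n) ℝ} {d : ℕ} {fmax fmin : ℝ}
    (h : IsPositiveOnCube f d fmax fmin) {x : Fin n → ℝ} (hx : x ∈ hypercube n) :
    fmin ≤ eval x f ∧ eval x f ≤ fmax :=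
  ⟨h.isLeast.2 ⟨x, hx, rfl⟩, h.isGreatest.2 ⟨x, hx, rfl⟩⟩

theorem IsPositiveOnCube.min_pos {f : MvPolynomial (Fin n) ℝ} {d : ℕ} {fmax fmin : ℝ}
    (h : IsPositiveOnCube f d fmax fmin) : 0 < fmin := by
  obtain ⟨x, hx, rfl⟩ := h.isLeast.1
  exact h.pos x hx

theorem IsPositiveOnCube.one_le_ratio {f : MvPolynomial (Fin n) ℝ} {d : ℕ} {fmax fmin : ℝ}
    (h : IsPositiveOnCube f d fmax fmin) : 1 ≤ fmax / fmin := by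
  rw [one_le_div h.min_pos]
  have := h.le_eval zero_mem_hypercube
  exact this.1.trans this.2

/-- An explicit constant for the Schmüdgen-type bound. -/
def schmudgenBound (n d : ℕ) : ℝ :=
  300 * ((d : ℝ) + 1) ^ 2 * ((multiIndices n d).card * 2 ^ min n d)

theorem isSchmudgenConstant_schmudgenBound (n d : ℕ) :
    IsSchmudgenConstant n d (schmudgenBound n d) := by
  set D : ℝ := (multiIndices n d).card * 2 ^ min n d with hD
  have hD1 : 1 ≤ D := by
    have h1 : (1 : ℝ) ≤ (multiIndices n d).card := by
      exact_mod_cast Finset.card_pos.2 ⟨0, mem_multiIndices.2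
        ((Finset.sum_eq_zero fun _ _ => rfl).le.trans (Nat.zero_le d))⟩
    exact one_le_mul_of_one_le_of_one_le h1 (one_le_pow₀ one_le_two)
  have hC : schmudgenBound n d = 300 * ((d : ℝ) + 1) ^ 2 * D := rfl
  refine ⟨by rw [hC]; positivity, fun f fmax fmin hf r hr => ?_⟩
  have hρ := hf.one_le_ratio
  have hmin := hf.min_pos
  set ρ := fmax / fmin with hρdef
  have hfmax : fmax = ρ * fmin := by rw [hρdef, div_mul_cancel₀ _ hmin.ne']
  have hr2 : schmudgenBound n d * ρ ≤ (r : ℝ) ^ 2 :=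
    (Real.sqrt_le_left (Nat.cast_nonneg r)).1 ((le_max_left _ _).trans hr)
  rw [hC] at hr2
  have hDρ : 1 ≤ D * ρ := one_le_mul_of_one_le_of_one_le hD1 hρ
  have hd0 : (0 : ℝ) ≤ d := Nat.cast_nonneg d
  have hr3 : (300 : ℝ) ≤ (r : ℝ) ^ 2 := by nlinarith [sq_nonneg (d : ℝ)]
  have hr4 : 18 ≤ r := by
    by_contra! h
    have : r ^ 2 ≤ 17 ^ 2 := Nat.pow_le_pow_left (by omega) 2
    have : (r : ℝ) ^ 2 ≤ 17 ^ 2 := by exact_mod_cast this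
    linarith
  -- The largest `q` with `4q ≤ r + 1`. Since `r ≥ 18` gives `r ≤ 5q`, the constant `300 = 12 · 5²`
  -- yields the factor `12` that the kernel argument requires.
  obtain ⟨q, hqdef⟩ : ∃ q, q = (r + 1) / 4 := ⟨_, rfl⟩
  have hrq : (r : ℝ) ≤ 5 * q := by exact_mod_cast (by omega : r ≤ 5 * q)
  have hq2 : 12 * (d : ℝ) ^ 2 * (D * ρ) ≤ (q : ℝ) ^ 2 := by
    have h1 : (r : ℝ) ^ 2 ≤ (5 * q) ^ 2 := by gcongr
    have h2 : (d : ℝ) ^ 2 * (D * ρ) ≤ ((d : ℝ) + 1) ^ 2 * (D * ρ) :=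
      mul_le_mul_of_nonneg_right (by nlinarith) (by linarith)
    nlinarith
  refine truncatedPreordering_mono _ (show 4 * q * n ≤ (r + 1) * n from
    Nat.mul_le_mul_right _ (by omega)) (mem_truncatedPreordering_of_kernel hf.degree_eq.le hmin
      (fun x hx => hf.le_eval hx) (by omega) ?_ ?_)
  · nlinarith [sq_nonneg (d : ℝ)]
  · rw [hfmax, ← hD]
    calc _ = 12 * (d : ℝ) ^ 2 * (D * ρ) * fmin := by ring
      _ ≤ _ := by gcongr

theorem schmudgenBound_le_poly_left (d : ℕ) :
    ∃ p : Polynomial ℝ, ∀ n : ℕ, 1 ≤ n → schmudgenBound n d ≤ p.eval (n : ℝ) := by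
  refine ⟨Polynomial.C (300 * ((d : ℝ) + 1) ^ 2) * ((Polynomial.X + 1) ^ d * 2 ^ d), fun n _ => ?_⟩
  have h1 : ((multiIndices n d).card : ℝ) ≤ (n + 1) ^ d := by
    exact_mod_cast card_multiIndices_le_pow' n d
  simp only [Polynomial.eval_mul, Polynomial.eval_C, Polynomial.eval_pow, Polynomial.eval_add,
    Polynomial.eval_X, Polynomial.eval_one, Polynomial.eval_ofNat, schmudgenBound]
  gcongr
  · norm_num
  · exact min_le_right _ _

theorem schmudgenBound_le_poly_right (n : ℕ) :
    ∃ p : Polynomial ℝ, ∀ d : ℕ, schmudgenBound n d ≤ p.eval (d : ℝ) := by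
  refine ⟨Polynomial.C 300 * (Polynomial.X + 1) ^ 2 * ((Polynomial.X + 1) ^ n * 2 ^ n),
    fun d => ?_⟩
  have h1 : ((multiIndices n d).card : ℝ) ≤ (d + 1) ^ n := by
    exact_mod_cast card_multiIndices_le_pow n d
  simp only [Polynomial.eval_mul, Polynomial.eval_C, Polynomial.eval_pow, Polynomial.eval_add,
    Polynomial.eval_X, Polynomial.eval_one, Polynomial.eval_ofNat, schmudgenBound]
  gcongr
  · norm_num
  · exact min_le_left _ _

end Schmudgen

/-! ### Growth of polynomials and of `T_d` beyond `1` -/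

section ChebyshevGrowth

open Polynomial
open Polynomial.Chebyshev hiding C

theorem one_add_sq_div_two_le_cosh (t : ℝ) : 1 + t ^ 2 / 2 ≤ Real.cosh t := by
  have h := Real.cosh_two_mul (t / 2)
  rw [mul_div_cancel₀ _ two_ne_zero, Real.cosh_sq] at h
  have h2 : (t / 2) ^ 2 ≤ Real.sinh (t / 2) ^ 2 := by
    rw [sq_le_sq]
    rcases le_total 0 (t / 2) with ht | ht
    · rw [abs_of_nonneg ht, abs_of_nonneg (Real.sinh_nonneg_iff.2 ht)]
      exact Real.self_le_sinh_iff.2 ht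
    · rw [abs_of_nonpos ht, abs_of_nonpos (Real.sinh_nonpos_iff.2 ht)]
      exact neg_le_neg (Real.sinh_le_self_iff.2 ht)
  linarith

/-- With `1 / (1 - δ) = cosh t` one has `T_d(cosh t) = cosh(dt) ≤ exp(dt)`. From `t² / 2 ≤ cosh t -
1 ≤ 4δ/3` follows `(dt)² ≤ 8/3`, well below `25`. -/
theorem isChebyshevConstant_exp_five : IsChebyshevConstant (Real.exp 5) := by
  refine ⟨Real.one_le_exp (by norm_num), le_rfl, fun d hd δ h0 h1 => ?_⟩
  have hd' : (2 : ℝ) ≤ d := by exact_mod_cast hd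
  have hd2 : (4 : ℝ) ≤ (d : ℝ) ^ 2 := by nlinarith
  rw [le_div_iff₀ (by positivity)] at h1
  have hδ : δ ≤ 1 / 4 := by nlinarith
  have hx : 1 ≤ 1 / (1 - δ) := by rw [one_le_div (by linarith)]; linarith
  set t := Real.arcosh (1 / (1 - δ)) with ht
  have ht0 : 0 ≤ t := Real.arcosh_nonneg hx
  have hc : Real.cosh t = 1 / (1 - δ) := Real.cosh_arcosh hx
  have hle := one_add_sq_div_two_le_cosh t
  rw [← hc, T_real_cosh]
  have h3 : 1 / (1 - δ) ≤ 1 + 4 / 3 * δ := by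
    rw [div_le_iff₀ (by linarith)]; nlinarith
  have h4 : (d * t) ^ 2 ≤ 5 ^ 2 := by
    have : t ^ 2 ≤ 8 / 3 * δ := by linarith
    nlinarith
  have h5 : d * t ≤ 5 := (pow_le_pow_iff_left₀ (by positivity) (by norm_num) two_ne_zero).1 h4
  calc Real.cosh (((d : ℕ) : ℤ) * t) ≤ Real.exp (d * t) := by
        rw [Real.cosh_eq, Int.cast_natCast]
        have : Real.exp (-(d * t)) ≤ Real.exp (d * t) :=
          Real.exp_le_exp.2 (by have : 0 ≤ d * t := by positivity
                                linarith)
        linarith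
    _ ≤ _ := Real.exp_le_exp.2 h5

theorem IsChebyshevConstant.two_le {c : ℝ} (hc : IsChebyshevConstant c) : 2 ≤ c := by
  -- `T_2(4/3) = 23/9` already exceeds `2`.
  have h := hc.2.2 2 le_rfl (1 / 4) (by norm_num) (by norm_num)
  rw [Nat.cast_ofNat, T_two] at h
  norm_num at h
  linarith

/-- Chebyshev extremality: beyond `1`, `T_d` dominates `p / M`, and its derivative dominates that of
`-p / M`. The second fact makes `T_d + p / M` increasing on `[1, ∞)`, which bounds the drop of `p`.
-/
theorem abs_eval_le_and_sub_le_of_one_le {d : ℕ} {p : ℝ[X]} (hp : p.natDegree ≤ d) {M : ℝ}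
    (hM : 0 < M) (h : ∀ x ∈ Set.Icc (-1 : ℝ) 1, |p.eval x| ≤ M) {R : ℝ} (hR : 1 ≤ R) :
    p.eval R ≤ M * (T ℝ d).eval R ∧ p.eval 1 - p.eval R ≤ M * ((T ℝ d).eval R - 1) := by
  have hb : ∀ b : ℝ, |b| = M⁻¹ → (C b * p).degree ≤ d ∧
      ∀ x ∈ Set.Icc (-1 : ℝ) 1, |(C b * p).eval x| ≤ 1 := fun b hb => by
    refine ⟨degree_le_of_natDegree_le ((natDegree_C_mul_le _ _).trans hp), fun x hx => ?_⟩
    rw [eval_mul, eval_C, abs_mul, hb, inv_mul_le_one₀ hM]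
    exact h x hx
  have h1 := hb M⁻¹ (abs_of_pos (inv_pos.2 hM))
  have h2 := hb (-M⁻¹) (by rw [abs_neg, abs_of_pos (inv_pos.2 hM)])
  constructor
  · have := eval_iterate_derivative_le_of_forall_abs_le_one (k := 0) hR h1.1 h1.2
    simp only [Function.iterate_zero, id, eval_mul, eval_C] at this
    rwa [inv_mul_le_iff₀ hM] at this
  · have hmono : MonotoneOn (fun x => (T ℝ d + C M⁻¹ * p).eval x) (Set.Ici 1) := by
      refine monotoneOn_of_deriv_nonneg (convex_Ici 1) (Polynomial.continuous _).continuousOn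
        (Polynomial.differentiable _).differentiableOn fun x hx => ?_
      rw [interior_Ici, Set.mem_Ioi] at hx
      rw [Polynomial.deriv]
      have := eval_iterate_derivative_le_of_forall_abs_le_one (k := 1) hx.le h2.1 h2.2
      simp only [Function.iterate_one, derivative_C_mul, eval_mul, eval_C] at this
      simp only [derivative_add, derivative_C_mul, eval_add, eval_mul, eval_C]
      linarith
    have := hmono (Set.mem_Ici.2 le_rfl) (Set.mem_Ici.2 hR) hR
    simp only [eval_add, eval_mul, eval_C, T_eval_one] at this
    have h3 : M⁻¹ * (p.eval 1 - p.eval R) ≤ (T ℝ d).eval R - 1 := by linarith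
    rwa [inv_mul_le_iff₀ hM] at h3

theorem convexOn_eval_T (d : ℕ) : ConvexOn ℝ (Set.Ici 1) fun x => (T ℝ d).eval x := by
  refine convexOn_of_deriv2_nonneg (convex_Ici 1) (Polynomial.continuous _).continuousOn
    (Polynomial.differentiable _).differentiableOn ?_ fun x hx => ?_
  · have : deriv (fun x => (T ℝ d).eval x) = fun x => (derivative (T ℝ d)).eval x := by
      ext x; rw [Polynomial.deriv]
    rw [this]; exact (Polynomial.differentiable _).differentiableOn
  · rw [interior_Ici, Set.mem_Ioi] at hx
    -- Extremality applied to the zero polynomial says that the second derivative of `T_d` is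
    -- nonnegative.
    have h := eval_iterate_derivative_le_of_forall_abs_le_one (n := d) (P := 0) (k := 2) hx.le
      (by simp) (by simp)
    have h2 : deriv^[2] (fun x => (T ℝ d).eval x) x = (derivative^[2] (T ℝ d)).eval x := by
      simp only [Function.iterate_succ, Function.iterate_zero, Function.comp, id]
      have : deriv (fun x => (T ℝ d).eval x) = fun x => (derivative (T ℝ d)).eval x := by
        ext x; rw [Polynomial.deriv]
      rw [this, Polynomial.deriv]
    rw [h2]
    simpa using h

/-- Convexity of `T_d` between `1` and `R₀ = 1 / (1 - 1/d²)`, where its value is at most `c`, makes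
the excess over `1` linear in `δ`. For `d = 1` there is no such `R₀`, and `c ≥ 2` suffices. -/
theorem IsChebyshevConstant.eval_T_sub_one_le {c : ℝ} (hc : IsChebyshevConstant c) {d : ℕ}
    (hd : 1 ≤ d) {δ : ℝ} (h0 : 0 < δ) (h1 : δ * (2 * (d : ℝ) ^ 2) ≤ 1) :
    (T ℝ d).eval (1 / (1 - δ)) - 1 ≤ δ * d ^ 2 * c := by
  have hd' : (1 : ℝ) ≤ d := by exact_mod_cast hd
  have hδ : δ ≤ 1 / 2 := by
    have := mul_le_mul_of_nonneg_left (one_le_pow₀ hd' (n := 2)) h0.le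
    linarith
  have hc2 := hc.two_le
  rcases hd.eq_or_lt with rfl | hd2
  · simp only [Nat.cast_one, T_one, eval_X]
    have : 1 / (1 - δ) ≤ 1 + 2 * δ := by
      rw [div_le_iff₀ (by linarith)]; nlinarith
    nlinarith
  · have hd2' : (2 : ℝ) ≤ d := by exact_mod_cast hd2
    have hdd : (4 : ℝ) ≤ (d : ℝ) ^ 2 := by nlinarith
    have hT := hc.2.2 d hd2 (1 / (d : ℝ) ^ 2) (by positivity) le_rfl
    set R₀ : ℝ := 1 / (1 - 1 / (d : ℝ) ^ 2) with hR₀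
    have hR₀' : R₀ = d ^ 2 / (d ^ 2 - 1) := by rw [hR₀]; field_simp
    have hpos : 0 < (d : ℝ) ^ 2 - 1 := by linarith
    have hR1 : 1 ≤ R₀ := by rw [hR₀', one_le_div hpos]; linarith
    -- The ratio `(R - 1) / (R₀ - 1)` for `R = 1 / (1 - δ)`, the position of `R` between `1` and
    -- `R₀`.
    set θ : ℝ := δ * (d ^ 2 - 1) / (1 - δ) with hθ
    have hδ1 : 0 < 1 - δ := by linarith
    have hθ0 : 0 ≤ θ := by positivity
    have hθd : θ ≤ δ * d ^ 2 := by
      rw [hθ, div_le_iff₀ hδ1]; nlinarith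
    have hθ1 : θ ≤ 1 := by nlinarith
    have hcomb : (1 - θ) • (1 : ℝ) + θ • R₀ = 1 / (1 - δ) := by
      rw [smul_eq_mul, smul_eq_mul, hR₀', hθ]; field_simp; ring
    have := (convexOn_eval_T d).2 (Set.mem_Ici.2 le_rfl) (Set.mem_Ici.2 hR1)
      (sub_nonneg.2 hθ1) hθ0 (sub_add_cancel 1 θ)
    simp only [hcomb] at this
    simp only [T_eval_one, smul_eq_mul] at this
    nlinarith

end ChebyshevGrowth

/-! ### Dilations and restriction to lines -/

section Scaling

open MvPolynomial

variable {n : ℕ}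

/-- The substitution `x ↦ R x`. -/
def scaleHom (n : ℕ) (R : ℝ) : MvPolynomial (Fin n) ℝ →ₐ[ℝ] MvPolynomial (Fin n) ℝ :=
  aeval fun i => C R * X i

theorem totalDegree_scaleHom_le (R : ℝ) (f : MvPolynomial (Fin n) ℝ) :
    (scaleHom n R f).totalDegree ≤ f.totalDegree := by
  conv_lhs => rw [f.as_sum, map_sum]
  refine totalDegree_finsetSum_le fun s hs => ?_
  rw [scaleHom, aeval_monomial]
  refine (totalDegree_mul _ _).trans ?_
  rw [algebraMap_eq, totalDegree_C, zero_add]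
  refine le_trans ?_ (le_totalDegree hs)
  refine (totalDegree_finsetProd _ _).trans (Finset.sum_le_sum fun i _ => ?_)
  refine (totalDegree_pow _ _).trans ?_
  have : (C R * X i : MvPolynomial (Fin n) ℝ).totalDegree ≤ 1 :=
    (totalDegree_mul _ _).trans (by simp)
  simpa using Nat.mul_le_mul_left (s i) this

theorem scaleHom_inv_scaleHom {R : ℝ} (hR : R ≠ 0) (f : MvPolynomial (Fin n) ℝ) :
    scaleHom n R⁻¹ (scaleHom n R f) = f := by
  have : (scaleHom n R⁻¹).comp (scaleHom n R) = AlgHom.id ℝ _ := by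
    ext1 i
    simp only [scaleHom, AlgHom.comp_apply, aeval_X, map_mul, algHom_C, algebraMap_eq,
      AlgHom.id_apply]
    rw [← mul_assoc, ← C_mul, mul_inv_cancel₀ hR, C_1, one_mul]
  exact DFunLike.congr_fun this f

theorem totalDegree_scaleHom {R : ℝ} (hR : R ≠ 0) (f : MvPolynomial (Fin n) ℝ) :
    (scaleHom n R f).totalDegree = f.totalDegree := by
  refine le_antisymm (totalDegree_scaleHom_le R f) ?_
  conv_lhs => rw [← scaleHom_inv_scaleHom hR f]
  exact totalDegree_scaleHom_le _ _

/-- The restriction of a polynomial to the line through the origin and `x`. -/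
def lineRestrict (x : Fin n → ℝ) : MvPolynomial (Fin n) ℝ →ₐ[ℝ] Polynomial ℝ :=
  aeval fun i => Polynomial.C (x i) * Polynomial.X

theorem natDegree_lineRestrict_le (x : Fin n → ℝ) (f : MvPolynomial (Fin n) ℝ) :
    (lineRestrict x f).natDegree ≤ f.totalDegree := by
  simpa [lineRestrict] using aeval_natDegree_le f le_rfl (fun i => Polynomial.C (x i) * Polynomial.X)
    (n := 1) fun i => (Polynomial.natDegree_C_mul_le _ _).trans Polynomial.natDegree_X_le

theorem eval_lineRestrict (x : Fin n → ℝ) (t : ℝ) (f : MvPolynomial (Fin n) ℝ) :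
    (lineRestrict x f).eval t = eval (fun i => x i * t) f := by
  have : (Polynomial.aeval t).comp (lineRestrict x) = aeval (R := ℝ) fun i => x i * t := by
    ext1 i
    simp [lineRestrict]
  have h := DFunLike.congr_fun this f
  rw [AlgHom.comp_apply, Polynomial.coe_aeval_eq_eval] at h
  rw [h, ← coe_aeval_eq_eval]; rfl

theorem eval_scaleHom (R : ℝ) (x : Fin n → ℝ) (f : MvPolynomial (Fin n) ℝ) :
    eval x (scaleHom n R f) = (lineRestrict x f).eval R := by
  rw [eval_lineRestrict]
  have : (aeval (R := ℝ) x).comp (scaleHom n R) = aeval (R := ℝ) fun i => x i * R := by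
    ext1 i
    simp [scaleHom, mul_comm]
  have h := DFunLike.congr_fun this f
  rw [AlgHom.comp_apply] at h
  exact h

/-- On the line `t ↦ t x` the segment `[-1, 1]` stays in the cube and `t = R` is the dilated point,
so the univariate growth bounds apply, with `f x ≥ fmin` at `t = 1`. -/
theorem IsPositiveOnCube.eval_scaleHom_bounds {f : MvPolynomial (Fin n) ℝ} {d : ℕ}
    {fmax fmin : ℝ} (hf : IsPositiveOnCube f d fmax fmin) {R : ℝ} (hR : 1 ≤ R)
    {x : Fin n → ℝ} (hx : x ∈ hypercube n) :
    fmin - fmax * ((Polynomial.Chebyshev.T ℝ d).eval R - 1) ≤ eval x (scaleHom n R f) ∧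
      eval x (scaleHom n R f) ≤ fmax * (Polynomial.Chebyshev.T ℝ d).eval R := by
  have hmin := hf.min_pos
  have hbox : ∀ t ∈ Set.Icc (-1 : ℝ) 1, (fun i => x i * t) ∈ hypercube n := fun t ht => by
    have h : ∀ i, |x i * t| ≤ 1 := fun i => by
      rw [abs_mul]
      exact mul_le_one₀ (abs_le.2 ⟨hx.1 i, hx.2 i⟩) (abs_nonneg _) (abs_le.2 ht)
    exact ⟨fun i => (abs_le.1 (h i)).1, fun i => (abs_le.1 (h i)).2⟩
  have hb : ∀ t ∈ Set.Icc (-1 : ℝ) 1, fmin ≤ (lineRestrict x f).eval t ∧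
      (lineRestrict x f).eval t ≤ fmax := fun t ht => by
    rw [eval_lineRestrict]; exact hf.le_eval (hbox t ht)
  have h1 := hb 1 (by simp)
  obtain ⟨h2, h3⟩ := abs_eval_le_and_sub_le_of_one_le
    ((natDegree_lineRestrict_le x f).trans hf.degree_eq.le) (M := fmax) (by linarith)
    (fun t ht => abs_le.2 ⟨by linarith [(hb t ht).1], (hb t ht).2⟩) hR
  rw [eval_scaleHom]
  exact ⟨by linarith, h2⟩

theorem exists_isPositiveOnCube {f : MvPolynomial (Fin n) ℝ} {d : ℕ} (hd : f.totalDegree = d)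
    (hpos : ∀ x ∈ hypercube n, 0 < eval x f) :
    ∃ x ∈ hypercube n, ∃ y ∈ hypercube n, IsPositiveOnCube f d (eval x f) (eval y f) := by
  have hcpt : IsCompact (hypercube n) := isCompact_Icc
  have hne : (hypercube n).Nonempty := ⟨0, zero_mem_hypercube⟩
  have hcont : ContinuousOn (fun x => eval x f) (hypercube n) :=
    (MvPolynomial.continuous_eval f).continuousOn
  obtain ⟨x, hx, hx'⟩ := hcpt.exists_isMaxOn hne hcont
  obtain ⟨y, hy, hy'⟩ := hcpt.exists_isMinOn hne hcont
  refine ⟨x, hx, y, hy, hd, hpos, ⟨⟨x, hx, rfl⟩, ?_⟩, ⟨y, hy, rfl⟩, ?_⟩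
  · rintro _ ⟨z, hz, rfl⟩; exact hx' hz
  · rintro _ ⟨z, hz, rfl⟩; exact hy' hz

end Scaling

/-! ### From the preordering to the quadratic module through a single generator -/

section PowerConstraint

open MvPolynomial

variable {n : ℕ}

/-- The polynomial `∑ i, (1 - x_i ^ (2 k))`. -/
def powerConstraint (n k : ℕ) : MvPolynomial (Fin n) ℝ := ∑ i, (1 - X i ^ (2 * k))

theorem totalDegree_one_sub_X_pow_le (k : ℕ) (i : Fin n) :
    (1 - X i ^ (2 * k) : MvPolynomial (Fin n) ℝ).totalDegree ≤ 2 * k := by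
  refine (totalDegree_sub _ _).trans (max_le ?_ ?_)
  · simp
  · rw [totalDegree_X_pow]

theorem totalDegree_powerConstraint_le (k : ℕ) : (powerConstraint n k).totalDegree ≤ 2 * k :=
  totalDegree_finsetSum_le fun i _ => totalDegree_one_sub_X_pow_le k i

/-- Elements `s + t * ∑ i, (1 - x_i ^ (2 k))` of the quadratic module generated by a single
polynomial, with `s` of degree at most `e` and `t` of degree at most `e - 2 k`; the latter bound
is expressed by multiplying with arbitrary polynomials of degree at most `2 k`. -/
def powerModule (n k e : ℕ) : Set (MvPolynomial (Fin n) ℝ) :=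
  {p | ∃ s t : MvPolynomial (Fin n) ℝ, IsSumSq s ∧ IsSumSq t ∧ s.totalDegree ≤ e ∧
    (∀ v : MvPolynomial (Fin n) ℝ, v.totalDegree ≤ 2 * k → (t * v).totalDegree ≤ e) ∧
    p = s + t * powerConstraint n k}

/-- The product of the two generator terms carries the square of the generator and joins the
sum-of-squares part. With several generators, mixed products would remain. -/
theorem powerModule_mul_mem {k e e' : ℕ} {p p' : MvPolynomial (Fin n) ℝ}
    (hp : p ∈ powerModule n k e) (hp' : p' ∈ powerModule n k e') :
    p * p' ∈ powerModule n k (e + e') := by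
  obtain ⟨s, t, h1, h2, h3, h4, rfl⟩ := hp
  obtain ⟨s', t', k1, k2, k3, k4, rfl⟩ := hp'
  have hh := totalDegree_powerConstraint_le (n := n) k
  refine ⟨s * s' + t * powerConstraint n k * (t' * powerConstraint n k), s * t' + s' * t,
    (h1.mul k1).add ?_, (h1.mul k2).add (k1.mul h2), ?_, fun v hv => ?_, by ring⟩
  · rw [mul_mul_mul_comm]; exact (h2.mul k2).mul (.mul_self _)
  · refine (totalDegree_add _ _).trans (max_le ?_ ?_)
    · exact (totalDegree_mul _ _).trans (add_le_add h3 k3)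
    · exact (totalDegree_mul _ _).trans (add_le_add (h4 _ hh) (k4 _ hh))
  · rw [add_mul, mul_assoc, mul_assoc]
    refine (totalDegree_add _ _).trans (max_le ?_ ?_)
    · exact (totalDegree_mul _ _).trans (add_le_add h3 (k4 v hv))
    · exact (totalDegree_mul _ _).trans ((add_le_add k3 (h4 v hv)).trans (add_comm _ _).le)

theorem powerModule_prod_mem {ι : Type*} {k e : ℕ} (I : Finset ι)
    (p : ι → MvPolynomial (Fin n) ℝ) (h : ∀ i ∈ I, p i ∈ powerModule n k e) (hI : I.Nonempty) :
    ∏ i ∈ I, p i ∈ powerModule n k (e * I.card) := by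
  induction hI using Finset.Nonempty.cons_induction with
  | singleton a => simpa using h a (by simp)
  | cons a s ha hs ih =>
    rw [Finset.prod_cons, Finset.card_cons, mul_add, mul_one, add_comm]
    exact powerModule_mul_mem (h a (by simp)) (ih fun i hi => h i (by simp [hi]))

/-- The tangent-line remainder `y ^ (2 k) - 1 - k (y ^ 2 - 1)` is a sum of squares. -/
theorem isSumSq_pow_sub_tangent {y : MvPolynomial (Fin n) ℝ} (hy : y.totalDegree ≤ 1) {k : ℕ}
    (hk : 1 ≤ k) :
    IsSumSq ((y ^ 2) ^ k - 1 - k * (y ^ 2 - 1)) ∧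
      ((y ^ 2) ^ k - 1 - k * (y ^ 2 - 1)).totalDegree ≤ 2 * k := by
  have hy2 : (y ^ 2).totalDegree ≤ 2 := (totalDegree_pow _ _).trans (by omega)
  induction k, hk using Nat.le_induction with
  | base => simp
  | succ k hk ih =>
    -- The increment is `(y² - 1)(y^(2k) - 1)`, and a geometric sum extracts a second factor `y² -
    -- 1`.
    have hid : (y ^ 2) ^ (k + 1) - 1 - ((k + 1 : ℕ) : MvPolynomial (Fin n) ℝ) * (y ^ 2 - 1) =
        ((y ^ 2) ^ k - 1 - k * (y ^ 2 - 1)) +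
          (y ^ 2 - 1) ^ 2 * ∑ j ∈ Finset.range k, (y ^ 2) ^ j := by
      have := geom_sum_mul (y ^ 2) k
      push_cast
      linear_combination -(y ^ 2 - 1) * this
    rw [hid]
    refine ⟨ih.1.add ((IsSquare.sq _).isSumSq.mul (IsSumSq.sum fun j _ => ?_)),
      (totalDegree_add _ _).trans (max_le (ih.2.trans (by omega)) ?_)⟩
    · exact ((IsSquare.sq y).pow j).isSumSq
    · have h1 : (y ^ 2 - 1).totalDegree ≤ 2 :=
        (totalDegree_sub _ _).trans (max_le hy2 (by simp))
      have h2 : (∑ j ∈ Finset.range k, (y ^ 2) ^ j).totalDegree ≤ 2 * (k - 1) := by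
        refine totalDegree_finsetSum_le fun j hj => (totalDegree_pow _ _).trans ?_
        have hj' := Finset.mem_range.1 hj
        calc j * (y ^ 2).totalDegree ≤ (k - 1) * 2 := Nat.mul_le_mul (by omega) hy2
          _ = _ := mul_comm _ _
      have h3 : ((y ^ 2 - 1) ^ 2).totalDegree ≤ 4 := (totalDegree_pow _ _).trans (by omega)
      exact (totalDegree_mul _ _).trans (by omega)

/-- For `y = x_i / R` the tangent inequality reduces `k (1 - y²)` to `1 - y^(2k) = 1 - x_i^(2k) /
n`. This is `1/n` times the power constraint plus the even powers of the other variables. -/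
theorem one_sub_sq_mem_powerModule {k : ℕ} (hk : 1 ≤ k) {R : ℝ}
    (hRn : R ^ (2 * k) = n) (i : Fin n) :
    1 - (C R⁻¹ * X i) ^ 2 ∈ powerModule n k (2 * k) := by
  have hn : (0 : ℝ) < n := by exact_mod_cast Fin.pos i
  have hk0 : (0 : ℝ) < k := by exact_mod_cast hk
  set y : MvPolynomial (Fin n) ℝ := C R⁻¹ * X i with hy
  have hy1 : y.totalDegree ≤ 1 := (totalDegree_mul _ _).trans (by simp)
  obtain ⟨h1, h2⟩ := isSumSq_pow_sub_tangent hy1 hk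
  have hsq : ∀ j : Fin n, IsSumSq (X j ^ (2 * k) : MvPolynomial (Fin n) ℝ) := fun j =>
    ((even_two_mul k).isSquare_pow (X j)).isSumSq
  refine ⟨C (k : ℝ)⁻¹ * ((y ^ 2) ^ k - 1 - (k : MvPolynomial (Fin n) ℝ) * (y ^ 2 - 1)) +
      C ((k : ℝ) * n)⁻¹ * ∑ j ∈ Finset.univ.erase i, X j ^ (2 * k), C ((k : ℝ) * n)⁻¹, ?_, ?_, ?_,
      fun v hv => ?_, ?_⟩
  · exact ((isSumSq_C (by positivity)).mul h1).add
      ((isSumSq_C (by positivity)).mul (IsSumSq.sum fun j _ => hsq j))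
  · exact isSumSq_C (by positivity)
  · refine (totalDegree_add _ _).trans (max_le ?_ ?_)
    · refine (totalDegree_mul _ _).trans ?_
      rw [totalDegree_C, zero_add]; exact h2
    · refine (totalDegree_mul _ _).trans ?_
      rw [totalDegree_C, zero_add]
      exact totalDegree_finsetSum_le fun j _ => by rw [totalDegree_X_pow]
  · refine (totalDegree_mul _ _).trans ?_
    rw [totalDegree_C, zero_add]; exact hv
  · have e1 : (y ^ 2) ^ k = C (n : ℝ)⁻¹ * X i ^ (2 * k) := by
      rw [← pow_mul, hy, mul_pow, ← C_pow, inv_pow, hRn]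
    have e2 : powerConstraint n k =
        C (n : ℝ) - (X i ^ (2 * k) + ∑ j ∈ Finset.univ.erase i, X j ^ (2 * k)) := by
      rw [Finset.add_sum_erase _ (fun j => X j ^ (2 * k)) (Finset.mem_univ i), powerConstraint, Finset.sum_sub_distrib]
      simp
    have e3 : (k : MvPolynomial (Fin n) ℝ) = C (k : ℝ) := by simp
    have e4 : (C (k : ℝ)⁻¹ * C (k : ℝ) : MvPolynomial (Fin n) ℝ) = 1 := by
      rw [← C_mul, inv_mul_cancel₀ hk0.ne', C_1]
    have e5 : (C (n : ℝ)⁻¹ * C (n : ℝ) : MvPolynomial (Fin n) ℝ) = 1 := by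
      rw [← C_mul, inv_mul_cancel₀ hn.ne', C_1]
    rw [e1, e2, e3, mul_inv, C_mul]
    linear_combination (y ^ 2 - 1) * e4 - C (k : ℝ)⁻¹ * e5

theorem mul_powerModule_mem_truncatedQuadraticModule {k e : ℕ} {σ p : MvPolynomial (Fin n) ℝ}
    (hσ : IsSumSq σ) (hp : p ∈ powerModule n k e) :
    σ * p ∈ truncatedQuadraticModule (cubeConstraint n) (σ.totalDegree + e) := by
  obtain ⟨s, t, h1, h2, h3, h4, rfl⟩ := hp
  have hg : ∀ i, (∑ j ∈ Finset.range k, X i ^ (2 * j)) * cubeConstraint n i = 1 - X i ^ (2 * k) :=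
    fun i => by
      simp only [pow_mul, cubeConstraint]
      exact geom_sum_mul_neg (X i ^ 2) k
  refine ⟨σ * s, fun i => σ * (t * ∑ j ∈ Finset.range k, X i ^ (2 * j)), hσ.mul h1,
    fun i => hσ.mul (h2.mul (IsSumSq.sum fun j _ => ?_)), ?_, fun i => ?_, ?_⟩
  · exact ((even_two_mul j).isSquare_pow (X i)).isSumSq
  · exact (totalDegree_mul _ _).trans (Nat.add_le_add_left h3 _)
  · rw [mul_assoc, mul_assoc, hg]
    exact (totalDegree_mul _ _).trans
      (Nat.add_le_add_left (h4 _ (totalDegree_one_sub_X_pow_le k i)) _)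
  · simp only [mul_assoc, hg]
    rw [← Finset.mul_sum, ← Finset.mul_sum, ← powerConstraint, mul_add]

theorem totalDegree_prod_cubeConstraint (I : Finset (Fin n)) :
    (∏ i ∈ I, cubeConstraint n i).totalDegree = 2 * I.card := by
  induction I using Finset.cons_induction with
  | empty => simp
  | cons a s ha ih =>
    rw [Finset.prod_cons, totalDegree_mul_of_isDomain (cubeConstraint_ne_zero a)
      (Finset.prod_ne_zero_iff.2 fun i _ => cubeConstraint_ne_zero i), ih,
      totalDegree_cubeConstraint, Finset.card_cons]
    ring

/-- The preordering of a slightly larger cube lies in the quadratic module of the unit cube. -/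
theorem scaleHom_mem_truncatedQuadraticModule {k D : ℕ} (hk : 1 ≤ k) {R : ℝ}
    (hRn : R ^ (2 * k) = n) {p : MvPolynomial (Fin n) ℝ}
    (hp : p ∈ truncatedPreordering (cubeConstraint n) D) :
    scaleHom n R⁻¹ p ∈ truncatedQuadraticModule (cubeConstraint n) (D + 2 * (k - 1) * n) := by
  obtain ⟨σ, h1, h2, rfl⟩ := hp
  rw [map_sum]
  refine truncatedQuadraticModule_sum_mem _ _ fun I _ => ?_
  -- For nonzero `σ I` degrees add exactly, so `deg σ_I ≤ D - 2 |I|`. Each constraint then costs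
  -- only the increase from `2` to `2k`.
  rcases eq_or_ne (σ I) 0 with h0 | h0
  · rw [h0, zero_mul, map_zero]; exact zero_mem_truncatedQuadraticModule _ _
  have hdeg := h2 I
  rw [totalDegree_mul_of_isDomain h0
    (Finset.prod_ne_zero_iff.2 fun i _ => cubeConstraint_ne_zero i),
    totalDegree_prod_cubeConstraint] at hdeg
  have hσ : IsSumSq (scaleHom n R⁻¹ (σ I)) := (h1 I).map_ringHom (scaleHom n R⁻¹).toRingHom
  have hσd := totalDegree_scaleHom_le R⁻¹ (σ I)
  rw [map_mul, map_prod]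
  rcases I.eq_empty_or_nonempty with rfl | hI
  · rw [Finset.prod_empty, mul_one]
    refine ⟨_, 0, hσ, fun _ => .zero, ?_, by simp, by simp⟩
    omega
  have hg : ∀ i ∈ I, scaleHom n R⁻¹ (cubeConstraint n i) ∈ powerModule n k (2 * k) := fun i _ => by
    have : scaleHom n R⁻¹ (cubeConstraint n i) = 1 - (C R⁻¹ * X i) ^ 2 := by
      simp [scaleHom, cubeConstraint]
    rw [this]
    exact one_sub_sq_mem_powerModule hk hRn i
  refine truncatedQuadraticModule_mono _ ?_
    (mul_powerModule_mem_truncatedQuadraticModule hσ (powerModule_prod_mem I _ hg hI))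
  have hIn : I.card ≤ n := (Finset.card_le_univ I).trans (by simp)
  have h3 : 2 * (k - 1) * I.card ≤ 2 * (k - 1) * n := Nat.mul_le_mul_left _ hIn
  have h4 : 2 * k * I.card = 2 * I.card + 2 * (k - 1) * I.card := by
    rw [← add_mul]; congr 1; omega
  omega

end PowerConstraint

/-! ### The case of one variable -/

section Univariate

open Polynomial

/-- Sums of squares certificates of degree at most `e` on `[-1, 1]`. -/
def intervalModule (e : ℕ) : Set ℝ[X] :=
  {p | ∃ A B : ℝ[X], IsSumSq A ∧ IsSumSq B ∧ A.natDegree ≤ e ∧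
    (B * (1 - X ^ 2)).natDegree ≤ e ∧ p = A + B * (1 - X ^ 2)}

theorem intervalModule_mul_mem {e e' : ℕ} {p p' : ℝ[X]} (hp : p ∈ intervalModule e)
    (hp' : p' ∈ intervalModule e') : p * p' ∈ intervalModule (e + e') := by
  obtain ⟨A, B, h1, h2, h3, h4, rfl⟩ := hp
  obtain ⟨A', B', k1, k2, k3, k4, rfl⟩ := hp'
  refine ⟨A * A' + B * (1 - X ^ 2) * (B' * (1 - X ^ 2)), A * B' + A' * B, (h1.mul k1).add ?_,
    (h1.mul k2).add (k1.mul h2), ?_, ?_, by ring⟩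
  · rw [mul_mul_mul_comm]; exact (h2.mul k2).mul (.mul_self _)
  · exact natDegree_add_le_of_degree_le (natDegree_mul_le_of_le h3 k3)
      (natDegree_mul_le_of_le h4 k4)
  · rw [add_mul, mul_assoc, mul_assoc]
    exact natDegree_add_le_of_degree_le (natDegree_mul_le_of_le h3 k4)
      ((natDegree_mul_le_of_le k3 h4).trans (add_comm _ _).le)

theorem isSumSq_polynomial_C {w : ℝ} (hw : 0 ≤ w) : IsSumSq (C w : ℝ[X]) := by
  rw [← Real.mul_self_sqrt hw, C_mul]
  exact IsSumSq.mul_self _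

/-- For `s = ±1` one has `1 + s x = (1 + s x)² / 2 + (1 - x²) / 2`. -/
theorem linear_mem_intervalModule {b c : ℝ} (h : |b| ≤ c) : C b * X + C c ∈ intervalModule 2 := by
  have key : ∀ s : ℝ, s ^ 2 = 1 → b = |b| * s → C b * X + C c ∈ intervalModule 2 := by
    intro s hs hb
    refine ⟨C (c - |b|) + C (|b| / 2) * (1 + C s * X) ^ 2, C (|b| / 2), ?_, ?_, ?_, ?_, ?_⟩
    · exact (isSumSq_polynomial_C (by linarith)).add
        ((isSumSq_polynomial_C (by positivity)).mul (IsSquare.sq _).isSumSq)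
    · exact isSumSq_polynomial_C (by positivity)
    · compute_degree
    · compute_degree
    · have e1 : (C s : ℝ[X]) ^ 2 = 1 := by rw [← C_pow, hs, C_1]
      have e2 : (C b : ℝ[X]) = C |b| * C s := by rw [← C_mul, ← hb]
      have e3 : (C |b| : ℝ[X]) = 2 * C (|b| / 2) := by
        rw [← map_ofNat C 2, ← C_mul]; congr 1; ring
      rw [e2, C_sub, e3]
      linear_combination (-C (|b| / 2) * X ^ 2) * e1
  rcases le_total 0 b with hb | hb
  · exact key 1 (by norm_num) (by rw [abs_of_nonneg hb, mul_one])
  · exact key (-1) (by norm_num) (by rw [abs_of_nonpos hb]; ring)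

/-- A real irreducible is linear, with its root outside the interval, or quadratic of negative
discriminant, where completing the square gives a square plus a positive constant up to sign. -/
theorem irreducible_mem_intervalModule {p : ℝ[X]} (hp : Irreducible p)
    (h0 : ∀ x ∈ Set.Icc (-1 : ℝ) 1, p.eval x ≠ 0) :
    p ∈ intervalModule (2 * p.natDegree) ∨ -p ∈ intervalModule (2 * p.natDegree) := by
  obtain ⟨a, b, c, habc⟩ : ∃ a b c : ℝ, p = C a * X ^ 2 + C b * X + C c :=
    ⟨_, _, _, eq_quadratic_of_degree_le_two hp.degree_le_two⟩
  have hev : ∀ x, p.eval x = a * x ^ 2 + b * x + c := fun x => by rw [habc]; simp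
  have hdeg := hp.natDegree_pos
  have hmono : ∀ {e e' : ℕ}, e ≤ e' → intervalModule e ⊆ intervalModule e' := by
    rintro e e' he q ⟨A, B, h1, h2, h3, h4, h5⟩
    exact ⟨A, B, h1, h2, h3.trans he, h4.trans he, h5⟩
  rcases eq_or_ne a 0 with rfl | ha
  · have hc : |b| < |c| := by
      by_contra! hcb
      have hb : b ≠ 0 := by
        rintro rfl
        have : c = 0 := by simpa using hcb
        exact hp.ne_zero (by rw [habc, this]; simp)
      refine h0 (-c / b) (abs_le.1 ?_) ?_
      · rw [abs_div, abs_neg]; exact div_le_one_of_le₀ hcb (abs_nonneg _)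
      · rw [hev]; field_simp; ring
    rcases le_total 0 c with hc0 | hc0
    · left
      rw [abs_of_nonneg hc0] at hc
      refine hmono (by omega : 2 ≤ _) ?_
      have := linear_mem_intervalModule hc.le
      rwa [habc, C_0, zero_mul, zero_add]
    · right
      rw [abs_of_nonpos hc0, ← abs_neg] at hc
      refine hmono (by omega : 2 ≤ _) ?_
      have := linear_mem_intervalModule hc.le
      rw [C_neg, C_neg] at this
      rw [habc, C_0, zero_mul, zero_add]
      convert! this using 1
      ring
  · have hd2 : p.natDegree = 2 := by rw [habc]; exact natDegree_quadratic ha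
    have hdisc : discrim a b c < 0 := by
      by_contra! hd
      obtain ⟨x, hx⟩ := exists_quadratic_eq_zero ha ⟨√(discrim a b c), (Real.mul_self_sqrt hd).symm⟩
      have hroot : p.IsRoot x := by rw [IsRoot, hev]; linear_combination hx
      have := degree_eq_one_of_irreducible_of_root hp hroot
      rw [degree_eq_natDegree hp.ne_zero, hd2] at this
      norm_num at this
    rw [discrim] at hdisc
    have hsq : ∀ w : ℝ, 0 ≤ w → ∀ q : ℝ[X],
        q = C w * ((C (2 * a) * X + C b) ^ 2 + C (4 * a * c - b ^ 2)) →
        q ∈ intervalModule (2 * p.natDegree) := by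
      rintro w hw q rfl
      refine hmono (by omega : 2 ≤ _) ⟨C w * ((C (2 * a) * X + C b) ^ 2 + C (4 * a * c - b ^ 2)), 0,
        (isSumSq_polynomial_C hw).mul
        ((IsSquare.sq _).isSumSq.add (isSumSq_polynomial_C (by linarith))), .zero, ?_,
        by simp, by simp⟩
      compute_degree
    have hid : ∀ w : ℝ, C w * ((C (2 * a) * X + C b) ^ 2 + C (4 * a * c - b ^ 2)) =
        C (w * (4 * a)) * p := fun w => by
      rw [habc]; simp only [C_mul, C_sub, C_pow]
      rw [map_ofNat C 2, map_ofNat C 4]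
      ring
    rcases lt_or_gt_of_ne ha with ha | ha
    · right
      refine hsq (-(4 * a)⁻¹) (by rw [neg_nonneg, inv_nonpos]; linarith) _ ?_
      rw [hid, neg_mul, inv_mul_cancel₀ (by linarith)]
      simp
    · left
      refine hsq (4 * a)⁻¹ (by positivity) _ ?_
      rw [hid, inv_mul_cancel₀ (by positivity)]
      simp

/-- The module is closed under products, so irreducible factors can be multiplied together.
Individual factors may be negative on the interval, hence the sign alternative. -/
theorem mem_intervalModule_or_neg (p : ℝ[X]) (h0 : ∀ x ∈ Set.Icc (-1 : ℝ) 1, p.eval x ≠ 0) :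
    p ∈ intervalModule (2 * p.natDegree) ∨ -p ∈ intervalModule (2 * p.natDegree) := by
  induction p using WfDvdMonoid.induction_on_irreducible with
  | zero => exact absurd eval_zero (h0 0 (by simp))
  | unit u hu =>
    obtain ⟨c, hc, rfl⟩ := Polynomial.isUnit_iff.1 hu
    rcases le_total 0 c with h | h
    · left
      exact ⟨C c, 0, isSumSq_polynomial_C h, .zero, by simp, by simp, by simp⟩
    · right
      exact ⟨C (-c), 0, isSumSq_polynomial_C (by linarith), .zero, by simp, by simp, by simp⟩
  | mul a i ha hi ih =>
    have h1 := ih fun x hx h => h0 x hx (by rw [eval_mul, h, mul_zero])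
    have h2 := irreducible_mem_intervalModule hi fun x hx h => h0 x hx (by rw [eval_mul, h, zero_mul])
    rw [natDegree_mul hi.ne_zero ha, mul_add]
    rcases h1 with h1 | h1 <;> rcases h2 with h2 | h2
    · exact .inl (intervalModule_mul_mem h2 h1)
    · right; simpa using intervalModule_mul_mem h2 h1
    · right; simpa using intervalModule_mul_mem h2 h1
    · left; simpa using intervalModule_mul_mem h2 h1

theorem mem_intervalModule_of_pos {p : ℝ[X]} (h0 : ∀ x ∈ Set.Icc (-1 : ℝ) 1, 0 < p.eval x) :
    p ∈ intervalModule (2 * p.natDegree) := by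
  refine (mem_intervalModule_or_neg p fun x hx => (h0 x hx).ne').resolve_right ?_
  rintro ⟨A, B, hA, hB, -, -, h⟩
  have h1 := congrArg (eval 0) h
  have h2 : 0 ≤ A.eval 0 := (hA.map_ringHom (evalRingHom 0)).nonneg
  have h3 : 0 ≤ B.eval 0 := (hB.map_ringHom (evalRingHom 0)).nonneg
  have h4 := h0 0 (by simp)
  simp at h1
  linarith

theorem mem_truncatedQuadraticModule_of_pos_one {f : MvPolynomial (Fin 1) ℝ}
    (hpos : ∀ x ∈ hypercube 1, 0 < MvPolynomial.eval x f) :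
    f ∈ truncatedQuadraticModule (cubeConstraint 1) (2 * f.totalDegree) := by
  set u : ℝ[X] := lineRestrict (fun _ => 1) f with hu
  have hdeg : u.natDegree ≤ f.totalDegree := natDegree_lineRestrict_le _ f
  have hfu : aeval (MvPolynomial.X 0 : MvPolynomial (Fin 1) ℝ) u = f := by
    have : ((aeval (MvPolynomial.X 0 : MvPolynomial (Fin 1) ℝ)).comp
        (lineRestrict fun _ : Fin 1 => (1 : ℝ))) = AlgHom.id ℝ _ := by
      ext1 i
      rw [Subsingleton.elim i 0]
      simp [lineRestrict]
    exact DFunLike.congr_fun this f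
  have hup : ∀ x ∈ Set.Icc (-1 : ℝ) 1, 0 < u.eval x := fun x hx => by
    rw [hu, eval_lineRestrict]
    exact hpos _ ⟨fun _ => by simpa using hx.1, fun _ => by simpa using hx.2⟩
  obtain ⟨A, B, h1, h2, h3, h4, h5⟩ := mem_intervalModule_of_pos hup
  refine ⟨aeval (MvPolynomial.X 0) A, fun _ => aeval (MvPolynomial.X 0) B,
    h1.map_ringHom (aeval (MvPolynomial.X 0)).toRingHom,
    fun _ => h2.map_ringHom (aeval (MvPolynomial.X 0)).toRingHom, ?_, fun i => ?_, ?_⟩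
  · exact (totalDegree_aeval_X_le 0 A).trans (h3.trans (by omega))
  · have : aeval (MvPolynomial.X 0) B * cubeConstraint 1 i =
        aeval (MvPolynomial.X 0) (B * (1 - X ^ 2)) := by
      rw [Subsingleton.elim i 0]; simp [cubeConstraint]
    rw [this]
    exact (totalDegree_aeval_X_le 0 _).trans (h4.trans (by omega))
  · rw [← hfu, h5]
    simp [cubeConstraint]

end Univariate

/-! ### Assembly of the bounds -/

section Main

open MvPolynomial

/-- The dilation by `n ^ (1 / (2 k))` does not change the range of `f` too much. -/
theorem IsPositiveOnCube.exists_scaleHom {n d : ℕ} {f : MvPolynomial (Fin n) ℝ} {fmax fmin : ℝ}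
    (hf : IsPositiveOnCube f d fmax fmin) {c : ℝ} (hc : IsChebyshevConstant c) (hn : 2 ≤ n)
    (hd : 1 ≤ d) {k : ℕ}
    (hk : 2 * c * (d : ℝ) ^ 2 * Real.log n * (fmax / fmin) ≤ 2 * k) (hk1 : 1 ≤ k) :
    ∃ R : ℝ, 0 < R ∧ R ^ (2 * k) = n ∧ ∃ gmax gmin : ℝ,
      IsPositiveOnCube (scaleHom n R f) d gmax gmin ∧ gmax / gmin ≤ 2 * c * (fmax / fmin) := by
  have hmin := hf.min_pos
  have hρ := hf.one_le_ratio
  set ρ := fmax / fmin with hρdef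
  have hfmax : fmax = ρ * fmin := by rw [hρdef, div_mul_cancel₀ _ hmin.ne']
  have hc2 := hc.two_le
  have hd' : (1 : ℝ) ≤ d := by exact_mod_cast hd
  have hd2 : (1 : ℝ) ≤ (d : ℝ) ^ 2 := one_le_pow₀ hd'
  have hk0 : (0 : ℝ) < k := by exact_mod_cast hk1
  have hn' : (1 : ℝ) < n := by exact_mod_cast hn
  have hlog : 0 < Real.log n := Real.log_pos hn'
  set s := Real.log n / (2 * k) with hs
  have hs0 : 0 < s := by positivity
  -- Chosen so that the dilation factor `exp s = n ^ (1 / (2k))` is `1 / (1 - δ)`.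
  set δ := 1 - Real.exp (-s) with hδ
  have hδ0 : 0 < δ := by rw [hδ, sub_pos, Real.exp_lt_one_iff]; linarith
  have hδs : δ ≤ s := by have := Real.add_one_le_exp (-s); linarith
  have hδb : δ * (2 * c * d ^ 2 * ρ) ≤ 1 := by
    calc δ * (2 * c * d ^ 2 * ρ) ≤ s * (2 * c * d ^ 2 * ρ) := by gcongr
      _ = 2 * c * (d : ℝ) ^ 2 * Real.log n * ρ / (2 * k) := by rw [hs]; ring
      _ ≤ 1 := div_le_one_of_le₀ hk (by positivity)
  have hR : Real.exp s = 1 / (1 - δ) := by rw [hδ, sub_sub_cancel, Real.exp_neg, one_div, inv_inv]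
  have hR1 : 1 ≤ Real.exp s := Real.one_le_exp hs0.le
  have hT := hc.eval_T_sub_one_le hd hδ0 (by
    refine le_trans (mul_le_mul_of_nonneg_left ?_ hδ0.le) hδb
    have : 1 ≤ c * ρ := one_le_mul_of_one_le_of_one_le (by linarith) hρ
    nlinarith)
  rw [← hR] at hT
  set τ := (Polynomial.Chebyshev.T ℝ d).eval (Real.exp s) with hτ
  have hτ1 : (τ - 1) * ρ ≤ 1 / 2 := by
    have := mul_le_mul_of_nonneg_right hT (show 0 ≤ ρ by linarith)
    linarith
  have hτ2 : 1 ≤ τ := by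
    rcases lt_or_ge τ 1 with h | h
    · exact absurd h (not_lt.2 (Polynomial.Chebyshev.one_le_eval_T_real d hR1))
    · exact h
  have hτ3 : τ ≤ c := by nlinarith
  have hbd : ∀ x ∈ hypercube n, fmin / 2 ≤ eval x (scaleHom n (Real.exp s) f) ∧
      eval x (scaleHom n (Real.exp s) f) ≤ c * fmax := fun x hx => by
    obtain ⟨h1, h2⟩ := hf.eval_scaleHom_bounds hR1 hx
    rw [← hτ] at h1 h2
    have hfm : 0 ≤ fmax := by rw [hfmax]; positivity
    refine ⟨?_, h2.trans (by rw [mul_comm]; gcongr)⟩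
    have : fmax * (τ - 1) ≤ fmin / 2 := by
      rw [hfmax]
      calc ρ * fmin * (τ - 1) = (τ - 1) * ρ * fmin := by ring
        _ ≤ 1 / 2 * fmin := by gcongr
        _ = fmin / 2 := by ring
    linarith
  refine ⟨Real.exp s, Real.exp_pos s, ?_, ?_⟩
  · rw [← Real.exp_nat_mul, hs]
    push_cast
    rw [mul_div_cancel₀ _ (by positivity), Real.exp_log (by linarith)]
  · obtain ⟨x, hx, y, hy, h⟩ := exists_isPositiveOnCube
      ((totalDegree_scaleHom (Real.exp_pos s).ne' f).trans hf.degree_eq)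
      fun x hx => lt_of_lt_of_le (by positivity) (hbd x hx).1
    refine ⟨_, _, h, ?_⟩
    rw [div_le_iff₀ h.min_pos]
    calc _ ≤ c * fmax := (hbd x hx).2
      _ = 2 * c * ρ * (fmin / 2) := by rw [hfmax]; ring
      _ ≤ _ := by gcongr; exact (hbd y hy).1

theorem mem_truncatedQuadraticModule_of_bound {c : ℝ} {n d : ℕ} {C : ℝ} (hn : 1 ≤ n)
    (hc : IsChebyshevConstant c) (hC : IsSchmudgenConstant n d C)
    {f : MvPolynomial (Fin n) ℝ} {fmax fmin : ℝ} (hf : IsPositiveOnCube f d fmax fmin) {r : ℕ}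
    (hr : 4 * c * (d : ℝ) ^ 2 * Real.log n * (fmax / fmin) +
      max (Real.pi * d * √(2 * n)) (√(2 * c * (fmax / fmin) * C)) ≤ (r : ℝ)) :
    f ∈ truncatedQuadraticModule (cubeConstraint n) (r * n) := by
  have hρ := hf.one_le_ratio
  have hc2 := hc.two_le
  set ρ := fmax / fmin with hρdef
  -- For `n = 1` the logarithmic term is zero and leaves no room for a dilation; the univariate
  -- degree `2d` fits below `πd√2`.
  rcases hn.eq_or_lt with rfl | hn2
  · refine truncatedQuadraticModule_mono _ ?_ (mem_truncatedQuadraticModule_of_pos_one hf.pos)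
    rw [hf.degree_eq, mul_one]
    have h1 : Real.pi * d * √(2 * (1 : ℕ)) ≤ r := by
      rw [show Real.log (1 : ℕ) = 0 by simp] at hr
      have := le_max_left (Real.pi * d * √(2 * (1 : ℕ))) (√(2 * c * ρ * C))
      linarith
    have h2 : 1 ≤ √(2 * (1 : ℕ) : ℝ) := Real.one_le_sqrt.2 (by norm_num)
    have h3 : (2 * d : ℝ) ≤ r := by
      refine le_trans ?_ h1
      calc (2 * d : ℝ) ≤ Real.pi * d := by gcongr; exact Real.two_le_pi
        _ ≤ _ := le_mul_of_one_le_right (by positivity) h2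
    exact_mod_cast h3
  rcases Nat.eq_zero_or_pos d with rfl | hd
  · have h1 := totalDegree_eq_zero_iff_eq_C.1 hf.degree_eq
    have h2 := hf.pos 0 zero_mem_hypercube
    rw [h1, eval_C] at h2
    rw [h1]
    exact ⟨_, 0, isSumSq_C h2.le, fun _ => .zero, by simp, by simp, by simp⟩
  have hd' : (1 : ℝ) ≤ d := by exact_mod_cast hd
  have hd2 : (1 : ℝ) ≤ (d : ℝ) ^ 2 := one_le_pow₀ hd'
  have hlog : 1 / 2 ≤ Real.log n := by
    have h2 : Real.log 2 ≤ Real.log n := Real.log_le_log (by norm_num) (by exact_mod_cast hn2)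
    linarith [Real.log_two_gt_d9]
  set M := max (Real.pi * d * √(2 * n)) (√(2 * c * ρ * C)) with hM
  set Y := 4 * c * (d : ℝ) ^ 2 * Real.log n * ρ with hY
  have hM0 : 0 ≤ M := le_max_of_le_right (Real.sqrt_nonneg _)
  have hY2 : 2 ≤ Y := by
    have h1 : 2 ≤ c * (d : ℝ) ^ 2 := by nlinarith
    have h2 : 1 ≤ c * (d : ℝ) ^ 2 * Real.log n := by nlinarith
    have h3 : 1 ≤ c * (d : ℝ) ^ 2 * Real.log n * ρ := one_le_mul_of_one_le_of_one_le h2 hρ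
    rw [hY]; nlinarith
  have hr'1 := Nat.le_ceil M
  have hr'2 := Nat.ceil_lt_add_one hM0
  obtain ⟨r', hr'⟩ : ∃ r', r' = ⌈M⌉₊ := ⟨_, rfl⟩
  rw [← hr'] at hr'1 hr'2
  have hlt : r' < r := by
    have : (r' : ℝ) < r := by linarith
    exact_mod_cast this
  -- The largest `k` with `r' + 1 + 2 (k - 1) ≤ r`. Then `2k ≥ r - r' ≥ Y - 1`, which is at least `Y
  -- / 2` because `Y ≥ 2`.
  obtain ⟨k, hk⟩ : ∃ k, k = (r - r' + 1) / 2 := ⟨_, rfl⟩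
  have hk1 : 1 ≤ k := by omega
  have hk2 : (r : ℝ) ≤ r' + 2 * k := by exact_mod_cast (by omega : r ≤ r' + 2 * k)
  obtain ⟨R, hR0, hRn, gmax, gmin, hg, hratio⟩ := hf.exists_scaleHom hc hn2 hd (k := k)
    (by
      have : 2 * c * (d : ℝ) ^ 2 * Real.log n * ρ = Y / 2 := by rw [hY]; ring
      rw [← hρdef, this]; linarith) hk1
  have hT := hC.2 _ _ _ hg r' (by
    refine le_trans (max_le ?_ (le_max_left _ _)) hr'1
    refine le_trans (Real.sqrt_le_sqrt ?_) (le_max_right _ _)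
    rw [mul_comm C]
    exact mul_le_mul_of_nonneg_right hratio hC.1.le)
  have hQ := scaleHom_mem_truncatedQuadraticModule hk1 hRn hT
  rw [scaleHom_inv_scaleHom hR0.ne', ← add_mul] at hQ
  exact truncatedQuadraticModule_mono _ (Nat.mul_le_mul_right _ (by omega)) hQ

theorem exists_linear_bound {n : ℕ} (hn : 1 ≤ n) (d : ℕ) : ∃ a : ℝ, 0 < a ∧
    ∀ (f : MvPolynomial (Fin n) ℝ) (fmax fmin : ℝ), IsPositiveOnCube f d fmax fmin →
      ∀ r : ℕ, a * (fmax / fmin) ≤ (r : ℝ) →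
        f ∈ truncatedQuadraticModule (cubeConstraint n) (r * n) := by
  set c := Real.exp 5
  set D := schmudgenBound n d with hD
  have hDc := isSchmudgenConstant_schmudgenBound n d
  have hc := isChebyshevConstant_exp_five
  have hD0 : 0 < D := hDc.1
  have hlog : 0 ≤ Real.log n := Real.log_natCast_nonneg n
  have hc0 : 0 < c := Real.exp_pos 5
  refine ⟨4 * c * (d : ℝ) ^ 2 * Real.log n + (Real.pi * d * √(2 * n) + √(2 * c * D)) + 1,
    by positivity, fun f fmax fmin hf r hr => ?_⟩
  refine mem_truncatedQuadraticModule_of_bound hn hc hDc hf (le_trans ?_ hr)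
  have hρ := hf.one_le_ratio
  set ρ := fmax / fmin
  have hρ0 : 0 ≤ ρ := by linarith
  -- All terms are absorbed into multiples of `ρ`, using `√ρ ≤ ρ` for `ρ ≥ 1`.
  have h1 : √(2 * c * ρ * D) ≤ √(2 * c * D) * ρ := by
    rw [mul_right_comm, Real.sqrt_mul (by positivity)]
    gcongr
    exact Real.sqrt_le_iff.2 ⟨hρ0, by nlinarith⟩
  have h2 : Real.pi * d * √(2 * n) ≤ Real.pi * d * √(2 * n) * ρ :=
    le_mul_of_one_le_right (by positivity) hρ
  have h3 : max (Real.pi * d * √(2 * n)) (√(2 * c * ρ * D)) ≤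
      Real.pi * d * √(2 * n) * ρ + √(2 * c * D) * ρ :=
    max_le (by have : 0 ≤ √(2 * c * D) * ρ := by positivity
               linarith)
      (by have : 0 ≤ Real.pi * d * √(2 * n) * ρ := by positivity
          linarith)
  calc _ ≤ 4 * c * (d : ℝ) ^ 2 * Real.log n * ρ +
        (Real.pi * d * √(2 * n) * ρ + √(2 * c * D) * ρ) := by gcongr
    _ ≤ _ := by linarith

end Main

end

theorem mainTheorem1 :
    -- the absolute constant exists
    (∃ c : ℝ, IsChebyshevConstant c) ∧
    -- the constants `C(n, d)` exist, with polynomial growth in `n` and in `d` separately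
    (∃ C : ℕ → ℕ → ℝ,
      (∀ n d : ℕ, 1 ≤ n → IsSchmudgenConstant n d (C n d)) ∧
      (∀ d : ℕ, ∃ p : Polynomial ℝ, ∀ n : ℕ, 1 ≤ n → C n d ≤ p.eval (n : ℝ)) ∧
      (∀ n : ℕ, 1 ≤ n → ∃ p : Polynomial ℝ, ∀ d : ℕ, C n d ≤ p.eval (d : ℝ))) ∧
    -- the explicit bound
    (∀ (c : ℝ) (n d : ℕ) (C : ℝ), 1 ≤ n → IsChebyshevConstant c → IsSchmudgenConstant n d C →
      ∀ (f : MvPolynomial (Fin n) ℝ) (fmax fmin : ℝ), IsPositiveOnCube f d fmax fmin →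
        ∀ r : ℕ,
          4 * c * (d : ℝ) ^ 2 * Real.log n * (fmax / fmin) +
              max (Real.pi * d * √(2 * n)) (√(2 * c * (fmax / fmin) * C)) ≤ (r : ℝ) →
            f ∈ truncatedQuadraticModule (cubeConstraint n) (r * n)) ∧
    -- in particular, for fixed `n` and `d` the bound is `O(fmax / fmin)`
    (∀ n d : ℕ, 1 ≤ n → ∃ a : ℝ, 0 < a ∧
      ∀ (f : MvPolynomial (Fin n) ℝ) (fmax fmin : ℝ), IsPositiveOnCube f d fmax fmin →
        ∀ r : ℕ, a * (fmax / fmin) ≤ (r : ℝ) →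
          f ∈ truncatedQuadraticModule (cubeConstraint n) (r * n)) :=
  ⟨⟨_, isChebyshevConstant_exp_five⟩,
    ⟨schmudgenBound, fun n d _ => isSchmudgenConstant_schmudgenBound n d,
      schmudgenBound_le_poly_left, fun n _ => schmudgenBound_le_poly_right n⟩,
    fun _ _ _ _ hn hc hC _ _ _ hf _ hr => mem_truncatedQuadraticModule_of_bound hn hc hC hf hr,
    fun _ d hn => exists_linear_bound hn d⟩
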